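/- Boolean functions are maps $f\colon\{0,1\}^n\to\{0,1\}$ with $n\ge 1$ (the arity of $f$). For $f$ of arity $n$ and $g$ of arity $m$, write $f\le g$ if there is a map $\sigma\colon\{1,\dots,m\}\to\{1,\dots,n\}$ with $f(a_1,\dots,a_n)=g(a_{\sigma(1)},\dots,a_{\sigma(m)})$ for all $(a_1,\dots,a_n)\in\{0,1\}^n$; $f$ and $g$ are equivalent, $f\equiv g$, if $f\le g$ and $g\le f$. For $f$ of arity $n$ and $I=\{i,j\}$ with $1\le i<j\le n$, the identification minor $f_I$ is the $(n-1)$-ary function $f_I(a_1,\dots,a_{n-1})=f(a_1,\dots,a_{j-1},a_i,a_j,\dots,a_{n-1})$. The deck of $f$ is the multiset, and the set-deck of $f$ is the set, of the equivalence classes $f_I/{\equiv}$, where $I$ ranges over the two-element subsets of $\{1,\dots,n\}$. A function $f'$ of the same arity as $f$ is a reconstruction (respectively, a set-reconstruction) of $f$ if $f$ and $f'$ have the same deck (respectively, the same set-deck); $f$ and $f'$ are strongly hypomorphic if $f_I\equiv f'_I$ for every $I$. A class of functions is set-reconstructible if each of its members is equivalent to all of its set-reconstructions. A class $\mathcal K$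 is weakly reconstructible if each $f\in\mathcal K$ is equivalent to all of its reconstructions that belong to $\mathcal K$. A clone on $\{0,1\}$ is a class of Boolean functions that contains all projections and is closed under composition. Let $\Lambda$, $V$ and $L$ be the clones of all polynomial operations (operations obtained by composition from projections, constants and the basic operation) of the meet-semilattice $(\{0,1\};\wedge)$, the join-semilattice $(\{0,1\};\vee)$ and the group $(\{0,1\};+)$ of addition modulo $2$, respectively. For a class $\mathcal C$, let $\mathcal C^{(\ge n)}$ be the class of its members of arity at least $n$. **Theorem.** Let $\mathcal C$ be a clone on $\{0,1\}$. If $\mathcal C$ is included in $\Lambda$, $V$ or $L$, then $\mathcal C^{(\ge 4)}$ is set-reconstructible. Otherwise, $\mathcal C^{(\ge n)}$ is not weakly reconstructible for any $n\ge 1$, and $\mathcal C$ contains pairs of nonequivalent strongly hypomorphic functions of arbitrarily high arity (that is, for every $N$ there are an arity $n\ge N$ and two $n$-ary members of $\mathcal C$ that are strongly hypomorphic but not equivalent). -/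

import Mathlib

/-! Functions of several arguments, identification minors, decks and reconstructibility. -/

namespace SetRec

/-- The `n`-ary functions `Aⁿ → B`. -/
abbrev Fn (A B : Type) (n : ℕ) : Type := (Fin n → A) → B

/-- A class of functions of several arguments from `A` to `B`, given by its `n`-ary parts. -/
abbrev FnClass (A B : Type) : Type := (n : ℕ) → Set (Fn A B n)

/-! ### Minors and equivalence -/

/-- `f ≤ g`: there is `σ : [m] → [n]` with `f(a) = g(a σ)` for all `a ∈ Aⁿ`, where `a σ = a ∘ σ`. -/
def IsMinor {A B : Type} {n m : ℕ} (f : Fn A B n) (g : Fn A B m) : Prop :=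
  ∃ σ : Fin m → Fin n, ∀ a : Fin n → A, f a = g (a ∘ σ)

/-- `f ≡ g`: each of the two functions is a minor of the other. -/
def Equivalent {A B : Type} {n m : ℕ} (f : Fn A B n) (g : Fn A B m) : Prop :=
  IsMinor f g ∧ IsMinor g f

theorem IsMinor.refl {A B : Type} {n : ℕ} (f : Fn A B n) : IsMinor f f :=
  ⟨id, fun _ => rfl⟩

theorem IsMinor.trans {A B : Type} {n m l : ℕ} {f : Fn A B n} {g : Fn A B m} {h : Fn A B l}
    (hfg : IsMinor f g) (hgh : IsMinor g h) : IsMinor f h := by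
  obtain ⟨σ, hσ⟩ := hfg
  obtain ⟨τ, hτ⟩ := hgh
  exact ⟨σ ∘ τ, fun a => by rw [hσ, hτ, Function.comp_assoc]⟩

/-- The relation `≡` on functions of all arities. -/
def fnSetoid (A B : Type) : Setoid (Σ n : ℕ, Fn A B n) where
  r f g := Equivalent f.2 g.2
  iseqv :=
    { refl := fun f => ⟨IsMinor.refl f.2, IsMinor.refl f.2⟩
      symm := fun h => ⟨h.2, h.1⟩
      trans := fun h k => ⟨h.1.trans k.1, k.2.trans h.2⟩ }

/-- The equivalence classes `f / ≡`. -/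
abbrev EqClass (A B : Type) : Type := Quotient (fnSetoid A B)

/-- The equivalence class `f / ≡` of an `n`-ary function `f`. -/
def eqClass {A B : Type} {n : ℕ} (f : Fn A B n) : EqClass A B :=
  Quotient.mk (fnSetoid A B) ⟨n, f⟩

/-! ### Identification minors and decks -/

/-- The two-element subsets `I = {i, j}` of the index set, written as pairs
`(i, j) = (min I, max I)` with `i < j`. -/
abbrev Couples (n : ℕ) : Type := {p : Fin n × Fin n // p.1 < p.2}

/-- The map `δ_I : [n] → [n - 1]`: it sends `k` to `k` if `k < max I`, to `min I` if `k = max I`,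
and to `k - 1` if `k > max I`. -/
def delta {n : ℕ} (I : Couples n) (k : Fin n) : Fin (n - 1) :=
  ⟨if k < I.1.2 then (k : ℕ) else if k = I.1.2 then (I.1.1 : ℕ) else (k : ℕ) - 1, by
    have h1 : (I.1.1 : ℕ) < (I.1.2 : ℕ) := I.2
    have h2 : (I.1.2 : ℕ) < n := I.1.2.isLt
    have h3 : (k : ℕ) < n := k.isLt
    split_ifs with ha hb
    · have h4 : (k : ℕ) < (I.1.2 : ℕ) := ha
      omega
    · omega
    · have h4 : ¬ (k : ℕ) < (I.1.2 : ℕ) := ha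
      omega⟩

/-- The identification minor `f_I : Aⁿ⁻¹ → B`, `f_I(a) = f(a δ_I)`. -/
def identMinor {A B : Type} {n : ℕ} (f : Fn A B n) (I : Couples n) : Fn A B (n - 1) :=
  fun a => f (a ∘ delta I)

/-- The deck of `f`: the multiset of the classes `f_I / ≡`. -/
def deck {A B : Type} {n : ℕ} (f : Fn A B n) : Multiset (EqClass A B) :=
  (Finset.univ : Finset (Couples n)).val.map fun I => eqClass (identMinor f I)

/-- The set-deck of `f`: the set of the classes `f_I / ≡`. -/
def setDeck {A B : Type} {n : ℕ} (f : Fn A B n) : Set (EqClass A B) :=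
  Set.range fun I : Couples n => eqClass (identMinor f I)

/-! ### Reconstructibility -/

/-- `f'` is a reconstruction of `f` (of the same arity). -/
def IsReconstruction {A B : Type} {n : ℕ} (f f' : Fn A B n) : Prop := deck f = deck f'

/-- `f'` is a set-reconstruction of `f` (of the same arity). -/
def IsSetReconstruction {A B : Type} {n : ℕ} (f f' : Fn A B n) : Prop := setDeck f = setDeck f'

/-- `f` and `f'` are strongly hypomorphic: `f_I ≡ f'_I` for every `I`. -/
def StronglyHypomorphic {A B : Type} {n : ℕ} (f f' : Fn A B n) : Prop :=
  ∀ I : Couples n, Equivalent (identMinor f I) (identMinor f' I)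

/-- `f` is equivalent to all of its set-reconstructions. -/
def SetReconstructible {A B : Type} {n : ℕ} (f : Fn A B n) : Prop :=
  ∀ f' : Fn A B n, IsSetReconstruction f f' → Equivalent f f'

/-- All members of the class are set-reconstructible. -/
def FnClass.SetReconstructible {A B : Type} (C : FnClass A B) : Prop :=
  ∀ (n : ℕ) (f : Fn A B n), f ∈ C n → SetRec.SetReconstructible f

/-- Every member of the class is equivalent to all of its reconstructions inside the class. -/
def FnClass.WeaklyReconstructible {A B : Type} (C : FnClass A B) : Prop :=
  ∀ (n : ℕ) (f : Fn A B n), f ∈ C n →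
    ∀ f' : Fn A B n, f' ∈ C n → IsReconstruction f f' → Equivalent f f'

/-- `C^(≥ n)`: the members of `C` of arity at least `n`. -/
def FnClass.arityGE {A B : Type} (C : FnClass A B) (n : ℕ) : FnClass A B :=
  fun m => {f | n ≤ m ∧ f ∈ C m}

/-! ### Clones -/

/-- A clone on `A`: a class of operations of positive arity on `A` that contains all projections
and is closed under composition. -/
structure IsClone {A : Type} (C : FnClass A A) : Prop where
  pos : ∀ (n : ℕ) (f : Fn A A n), f ∈ C n → 0 < n
  proj : ∀ (n : ℕ) (i : Fin n), (fun a : Fin n → A => a i) ∈ C n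
  comp : ∀ (n m : ℕ) (f : Fn A A n) (g : Fin n → Fn A A m), f ∈ C n → (∀ i, g i ∈ C m) →
    (fun a : Fin m → A => f (fun i => g i a)) ∈ C m

/-- The `n`-ary polynomial operations of the algebra `(A; op)`: those obtained from projections
and constants by means of `op`. -/
inductive IsPolynomialOp {A : Type} (op : A → A → A) (n : ℕ) : Fn A A n → Prop
  | proj (i : Fin n) : IsPolynomialOp op n (fun a => a i)
  | const (c : A) : IsPolynomialOp op n (fun _ => c)
  | app (f g : Fn A A n) : IsPolynomialOp op n f → IsPolynomialOp op n g →
      IsPolynomialOp op n (fun a => op (f a) (g a))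

/-- The class of polynomial operations (of positive arity) of `(A; op)`. -/
def polynomialClone {A : Type} (op : A → A → A) : FnClass A A :=
  fun n => {f | 0 < n ∧ IsPolynomialOp op n f}

/-- `Λ`: polynomial operations of the meet-semilattice `({0, 1}; ∧)`. -/
def cloneLambda : FnClass Bool Bool := polynomialClone Bool.and

/-- `V`: polynomial operations of the join-semilattice `({0, 1}; ∨)`. -/
def cloneV : FnClass Bool Bool := polynomialClone Bool.or

/-- `L`: polynomial operations of the group of addition modulo `2` on `{0, 1}`
(negation is the identity map in this group, and the neutral element is a constant). -/
def cloneL : FnClass Bool Bool := polynomialClone Bool.xor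

/-- `C` is included in `Λ`, `V` or `L`. -/
def InLambdaVL (C : FnClass Bool Bool) : Prop :=
  (∀ n, C n ⊆ cloneLambda n) ∨ (∀ n, C n ⊆ cloneV n) ∨ (∀ n, C n ⊆ cloneL n)

end SetRec

namespace SetRec

/-! ### The maps `δ_I` -/

/-! The positive half. The operations in `Λ` are exactly the meet-homomorphisms, those in `L`
exactly the affine functions, and `V` is dual to `Λ`. Being a meet-homomorphism or affine passes to
minors and, from arity 4 on, can be checked on identification minors (`isMeetHom_of_identMinor`,
`isAffine_of_identMinor`). So every set-reconstruction of such a function, inside the clone or not,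
is of the same kind. Apart from the constant 0, handled separately, the function is a conjunction or
an affine sum over a set `S`. Its class depends only on `S.card` (and a constant term visible in any
card), and identifying two elements of `S` lowers this number by 1 or 2. Hence the set-deck reveals
it (`IsSetFamily.equivalent`).

The negative half. A clone outside `Λ`, `V` and `L` contains x ∧ (y ∨ z), its dual, or majority
(`IsClone.andOr_or_majOp_mem`). This is proved by explicit substitutions, without Post's
classification. The first and third cases each get a family of pairs; the second follows by duality.

Both families rest on monotone functions h_0 and h_1 (`parityFn`) on two-element blocks arranged by
a permutation `s` without fixed points or 2-cycles. They share a part `CycleTrue`; in addition h_ε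
is true on the transversals having parity ε. Exchanging the two elements of a block changes the
parity and preserves the common part except in a narrow situation. When two arguments are
identified, either transversals disappear or some block away from both arguments can be exchanged
safely. Globally no permutation works: the true points with at most three elements distinguish first
from second elements of blocks, and then the parity is an invariant.

The identification of arguments in different blocks is harmless for h_ε itself, but clones need not
contain all monotone functions. So x ∧ h_ε is used with x ∧ (y ∨ z), and a self-dual extension of
h_ε by two arguments with majority. Strong hypomorphy gives equal decks, which refutes weak
reconstructibility in every arity range. -/

theorem delta_max {n : ℕ} (I : Couples n) : delta I I.1.2 = delta I I.1.1 := by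
  have h : I.1.1 < I.1.2 := I.2
  simp [delta, h]

theorem eq_of_delta_eq {n : ℕ} {I : Couples n} {k l : Fin n} (h : delta I k = delta I l) :
    k = l ∨ (k = I.1.1 ∧ l = I.1.2) ∨ (k = I.1.2 ∧ l = I.1.1) := by
  obtain ⟨⟨i, j⟩, hij⟩ := I
  simp only [delta, Fin.ext_iff, Fin.lt_def] at h hij ⊢
  split_ifs at h <;> omega

theorem exists_comp_delta {A : Type} {n : ℕ} {I : Couples n} {a : Fin n → A}
    (h : a I.1.1 = a I.1.2) : ∃ b : Fin (n - 1) → A, b ∘ delta I = a := by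
  have hf : Function.FactorsThrough a (delta I) := by
    intro k l hkl
    rcases eq_of_delta_eq hkl with rfl | ⟨rfl, rfl⟩ | ⟨rfl, rfl⟩
    exacts [rfl, h, h.symm]
  exact ⟨Function.extend (delta I) a fun _ => a I.1.1, funext fun k => hf.extend_apply _ k⟩

theorem injOn_delta {n : ℕ} (I : Couples n) {S : Set (Fin n)}
    (h : ¬ (I.1.1 ∈ S ∧ I.1.2 ∈ S)) : Set.InjOn (delta I) S := by
  intro k hk l hl hkl
  rcases eq_of_delta_eq hkl with rfl | ⟨rfl, rfl⟩ | ⟨rfl, rfl⟩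
  exacts [rfl, absurd ⟨hk, hl⟩ h, absurd ⟨hl, hk⟩ h]

/-- The couple formed by two distinct indices. -/
theorem exists_couple {n : ℕ} {i j : Fin n} (h : i ≠ j) :
    ∃ I : Couples n, (I.1.1 = i ∧ I.1.2 = j) ∨ (I.1.1 = j ∧ I.1.2 = i) := by
  rcases lt_or_gt_of_ne h with h | h
  exacts [⟨⟨(i, j), h⟩, Or.inl ⟨rfl, rfl⟩⟩, ⟨⟨(j, i), h⟩, Or.inr ⟨rfl, rfl⟩⟩]

/-! ### Decks -/

theorem Equivalent.symm {A B : Type} {n m : ℕ} {f : Fn A B n} {g : Fn A B m}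
    (h : Equivalent f g) : Equivalent g f := ⟨h.2, h.1⟩

theorem IsSetReconstruction.symm {A B : Type} {n : ℕ} {f f' : Fn A B n}
    (h : IsSetReconstruction f f') : IsSetReconstruction f' f := Eq.symm h

theorem IsSetReconstruction.exists_equivalent {A B : Type} {n : ℕ} {f f' : Fn A B n}
    (h : IsSetReconstruction f f') (I : Couples n) :
    ∃ J : Couples n, Equivalent (identMinor f I) (identMinor f' J) := by
  have hI : eqClass (identMinor f I) ∈ setDeck f' := h ▸ Set.mem_range_self I
  obtain ⟨J, hJ⟩ := hI
  exact ⟨J, Quotient.exact hJ.symm⟩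

theorem isSetReconstruction_of_exists {A B : Type} {n : ℕ} {f f' : Fn A B n}
    (h : ∀ I, ∃ J : Couples n, Equivalent (identMinor f I) (identMinor f' J))
    (h' : ∀ I, ∃ J : Couples n, Equivalent (identMinor f' I) (identMinor f J)) :
    IsSetReconstruction f f' := by
  apply Set.Subset.antisymm
  · rintro _ ⟨I, rfl⟩
    obtain ⟨J, hJ⟩ := h I
    exact ⟨J, Quotient.sound hJ.symm⟩
  · rintro _ ⟨I, rfl⟩
    obtain ⟨J, hJ⟩ := h' I
    exact ⟨J, Quotient.sound hJ.symm⟩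

theorem StronglyHypomorphic.isReconstruction {A B : Type} {n : ℕ} {f f' : Fn A B n}
    (h : StronglyHypomorphic f f') : IsReconstruction f f' :=
  Multiset.map_congr rfl fun I _ => Quotient.sound (h I)

/-- Two identification minors are equivalent if the functions correspond to each other, on the
tuples with equal `i`-th and `j`-th entries, under a permutation of the arguments fixing `i`
and `j`. -/
theorem equivalent_identMinor_of_perm {A B : Type} {n : ℕ} {f g : Fn A B n} (I : Couples n)
    (ρ : Equiv.Perm (Fin n)) (h1 : ρ I.1.1 = I.1.1) (h2 : ρ I.1.2 = I.1.2)
    (h : ∀ a : Fin n → A, a I.1.1 = a I.1.2 → f a = g (a ∘ ρ)) :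
    Equivalent (identMinor f I) (identMinor g I) := by
  have key : ∀ (ρ : Equiv.Perm (Fin n)), ρ I.1.1 = I.1.1 → ρ I.1.2 = I.1.2 →
      ∀ f g : Fn A B n, (∀ a : Fin n → A, a I.1.1 = a I.1.2 → f a = g (a ∘ ρ)) →
      IsMinor (identMinor f I) (identMinor g I) := by
    intro ρ h1 h2 f g h
    have hf : Function.FactorsThrough (delta I ∘ ρ) (delta I) := by
      intro k l hkl
      rcases eq_of_delta_eq hkl with rfl | ⟨rfl, rfl⟩ | ⟨rfl, rfl⟩
      · rfl
      · simp [h1, h2, delta_max]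
      · simp [h1, h2, delta_max]
    refine ⟨Function.extend (delta I) (delta I ∘ ρ) id, fun b => ?_⟩
    have e : Function.extend (delta I) (delta I ∘ ρ) id ∘ delta I = delta I ∘ ρ :=
      funext fun k => hf.extend_apply _ k
    unfold identMinor
    rw [h _ (by simp [delta_max]), Function.comp_assoc, Function.comp_assoc, e]
  refine ⟨key ρ h1 h2 f g h, key ρ.symm (by rw [Equiv.symm_apply_eq, h1])
    (by rw [Equiv.symm_apply_eq, h2]) g f fun a ha => ?_⟩
  have e1 : ρ.symm I.1.1 = I.1.1 := by rw [Equiv.symm_apply_eq, h1]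
  have e2 : ρ.symm I.1.2 = I.1.2 := by rw [Equiv.symm_apply_eq, h2]
  rw [h (a ∘ ρ.symm) (by simp [e1, e2, ha]), Function.comp_assoc]
  simp

/-! ### Duality -/

/-- The dual `a ↦ ¬ f (¬ a)` of a Boolean function. -/
def dual {n : ℕ} (f : Fn Bool Bool n) : Fn Bool Bool n := fun a => !f fun i => !a i

@[simp] theorem dual_dual {n : ℕ} (f : Fn Bool Bool n) : dual (dual f) = f := by
  funext a
  simp [dual]

theorem IsMinor.dual {n m : ℕ} {f : Fn Bool Bool n} {g : Fn Bool Bool m} (h : IsMinor f g) :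
    IsMinor (dual f) (dual g) := by
  obtain ⟨σ, hσ⟩ := h
  refine ⟨σ, fun a => ?_⟩
  simp only [SetRec.dual, hσ]
  rfl

theorem Equivalent.dual {n m : ℕ} {f : Fn Bool Bool n} {g : Fn Bool Bool m}
    (h : Equivalent f g) : Equivalent (dual f) (dual g) := ⟨h.1.dual, h.2.dual⟩

theorem Equivalent.of_dual {n m : ℕ} {f : Fn Bool Bool n} {g : Fn Bool Bool m}
    (h : Equivalent (SetRec.dual f) (SetRec.dual g)) : Equivalent f g := by
  simpa using h.dual

theorem StronglyHypomorphic.dual {n : ℕ} {f g : Fn Bool Bool n} (h : StronglyHypomorphic f g) :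
    StronglyHypomorphic (dual f) (dual g) := fun I => (h I).dual

theorem IsSetReconstruction.dual {n : ℕ} {f f' : Fn Bool Bool n}
    (h : IsSetReconstruction f f') : IsSetReconstruction (dual f) (dual f') :=
  isSetReconstruction_of_exists
    (fun I => (h.exists_equivalent I).imp fun _ hJ => hJ.dual)
    (fun I => (h.symm.exists_equivalent I).imp fun _ hJ => hJ.dual)

/-- The class of the duals of the members of a class. -/
def dualClass (C : FnClass Bool Bool) : FnClass Bool Bool := fun n => {f | dual f ∈ C n}

theorem IsClone.dualClass {C : FnClass Bool Bool} (hC : IsClone C) : IsClone (dualClass C) where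
  pos n f hf := hC.pos n _ hf
  proj n i := by
    have h : SetRec.dual (fun a : Fin n → Bool => a i) = fun a => a i := by
      funext a
      simp [SetRec.dual]
    change SetRec.dual _ ∈ C n
    rw [h]
    exact hC.proj n i
  comp n m f g hf hg := by
    have h : SetRec.dual (fun a : Fin m → Bool => f fun i => g i a) =
        fun a => SetRec.dual f fun i => SetRec.dual (g i) a := by
      funext a
      simp [SetRec.dual]
    change SetRec.dual _ ∈ C m
    rw [h]
    exact hC.comp n m _ _ hf hg

/-! ### Meet-homomorphisms and conjunctions -/

/-- `f` preserves meets. -/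
def IsMeetHom {n : ℕ} (f : Fn Bool Bool n) : Prop :=
  ∀ a b : Fin n → Bool, f (fun i => a i && b i) = (f a && f b)

theorem IsMeetHom.of_isMinor {n m : ℕ} {f : Fn Bool Bool n} {g : Fn Bool Bool m}
    (hg : IsMeetHom g) (h : IsMinor f g) : IsMeetHom f := by
  obtain ⟨σ, hσ⟩ := h
  intro a b
  rw [hσ, hσ, hσ]
  exact hg _ _

theorem IsPolynomialOp.isMeetHom {n : ℕ} {f : Fn Bool Bool n}
    (h : IsPolynomialOp Bool.and n f) : IsMeetHom f := by
  induction h with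
  | proj i => exact fun a b => rfl
  | const c => exact fun a b => (Bool.and_self c).symm
  | app f g _ _ hf hg =>
    intro a b
    simp only [hf a b, hg a b]
    ac_rfl

/-- The conjunction of the arguments with index in `S`. -/
def conj (n : ℕ) (S : Finset (Fin n)) : Fn Bool Bool n := fun a => decide (∀ i ∈ S, a i = true)

theorem isPolynomialOp_conj {n : ℕ} (S : Finset (Fin n)) :
    IsPolynomialOp Bool.and n (conj n S) := by
  induction S using Finset.induction_on with
  | empty =>
    have h : conj n ∅ = fun _ => true := by
      funext a
      simp [conj]
    rw [h]
    exact .const true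
  | insert i S hi ih =>
    have h : conj n (insert i S) = fun a => Bool.and (a i) (conj n S a) := by
      funext a
      simp [conj]
    rw [h]
    exact .app _ _ (.proj i) ih

/-- Every tuple is the meet of the coatoms `c i` at its zero positions, so `f` is determined by its
values at the coatoms; `S` collects the coatoms sent to 0. -/
theorem IsMeetHom.eq_conj {n : ℕ} {f : Fn Bool Bool n} (hf : IsMeetHom f)
    (h : f (fun _ => true) = true) : ∃ S, f = conj n S := by
  let F : InfTopHom (Fin n → Bool) Bool := ⟨⟨f, hf⟩, h⟩
  let c : Fin n → Fin n → Bool := fun i => Function.update ⊤ i false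
  have top_eq : (⊤ : Bool) = true := rfl
  refine ⟨Finset.univ.filter fun i => f (c i) = false, funext fun a => ?_⟩
  have ha : a = (Finset.univ.filter fun i => a i = false).inf c := by
    funext k
    rw [Finset.inf_apply]
    cases hk : a k
    · symm
      rw [← Bool.not_eq_true, ← top_eq, Finset.inf_eq_top_iff]
      simp only [Finset.mem_filter, Finset.mem_univ, true_and]
      intro hh
      simpa [c] using hh k hk
    · symm
      rw [← top_eq, Finset.inf_eq_top_iff]
      intro i hi
      have : k ≠ i := by
        rintro rfl
        simp [hk] at hi
      simp [c, this]
  have hF : f a = (Finset.univ.filter fun i => a i = false).inf fun i => f (c i) := by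
    conv_lhs => rw [ha]
    exact map_finset_inf F _ _
  rw [hF, Bool.eq_iff_iff, ← top_eq, Finset.inf_eq_top_iff]
  simp only [Finset.mem_filter, Finset.mem_univ, true_and, conj, decide_eq_true_eq,
    top_eq]
  refine forall_congr' fun i => ?_
  cases a i <;> cases f (c i) <;> simp

theorem IsMeetHom.eq_false {n : ℕ} {f : Fn Bool Bool n} (hf : IsMeetHom f)
    (h : f (fun _ => true) = false) : f = fun _ => false := by
  funext a
  simpa [h] using hf a fun _ => true

theorem IsMeetHom.isPolynomialOp {n : ℕ} {f : Fn Bool Bool n} (hf : IsMeetHom f) :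
    IsPolynomialOp Bool.and n f := by
  cases h : f fun _ => true
  · rw [hf.eq_false h]
    exact .const false
  · obtain ⟨S, rfl⟩ := hf.eq_conj h
    exact isPolynomialOp_conj S

/-! ### Affine functions -/

/-- `f` commutes with addition up to the constant `f 0`. -/
def IsAffine {n : ℕ} (f : Fn Bool Bool n) : Prop :=
  ∀ a b : Fin n → Bool,
    f (fun i => a i ^^ b i) = (f a ^^ f b ^^ f fun _ => false)

theorem IsAffine.of_isMinor {n m : ℕ} {f : Fn Bool Bool n} {g : Fn Bool Bool m}
    (hg : IsAffine g) (h : IsMinor f g) : IsAffine f := by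
  obtain ⟨σ, hσ⟩ := h
  intro a b
  rw [hσ, hσ, hσ, hσ]
  exact hg _ _

theorem IsPolynomialOp.isAffine {n : ℕ} {f : Fn Bool Bool n}
    (h : IsPolynomialOp Bool.xor n f) : IsAffine f := by
  induction h with
  | proj i => intro a b; simp
  | const c => intro a b; simp
  | app f g _ _ hf hg =>
    intro a b
    simp only [hf a b, hg a b]
    generalize f a = x1, f b = x2, f (fun _ => false) = x3, g a = y1, g b = y2,
      g (fun _ => false) = y3
    revert x1 x2 x3 y1 y2 y3
    decide

/-- The sum of `c` and the arguments with index in `S`. -/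
def affineSum (c : Bool) (n : ℕ) (S : Finset (Fin n)) : Fn Bool Bool n :=
  fun a => c ^^ decide (Odd (S.filter fun i => a i = true).card)

theorem affineSum_empty (c : Bool) (n : ℕ) : affineSum c n ∅ = fun _ => c := by
  funext a
  simp [affineSum]

theorem affineSum_insert (c : Bool) {n : ℕ} {S : Finset (Fin n)} {i : Fin n} (hi : i ∉ S)
    (a : Fin n → Bool) : affineSum c n (insert i S) a = (a i ^^ affineSum c n S a) := by
  unfold affineSum
  rw [Finset.filter_insert]
  cases a i
  · simp
  · rw [if_pos rfl, Finset.card_insert_of_notMem (by simp [hi])]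
    by_cases h : Odd (S.filter fun i => a i = true).card <;>
      cases c <;> simp [Nat.odd_add_one, h, -Nat.not_odd_iff_even]

theorem isPolynomialOp_affineSum (c : Bool) {n : ℕ} (S : Finset (Fin n)) :
    IsPolynomialOp Bool.xor n (affineSum c n S) := by
  induction S using Finset.induction_on with
  | empty =>
    rw [affineSum_empty]
    exact .const c
  | insert i S hi ih =>
    rw [funext (affineSum_insert c hi)]
    exact .app _ _ (.proj i) ih

theorem affineSum_false (c : Bool) (n : ℕ) (S : Finset (Fin n)) :
    affineSum c n S (fun _ => false) = c := by
  simp [affineSum]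

/-- The set consists of the unit vectors at which `f` differs from its value at 0; induction on the
support then fixes all values. -/
theorem IsAffine.eq_affineSum {n : ℕ} {f : Fn Bool Bool n} (hf : IsAffine f) :
    ∃ S, f = affineSum (f fun _ => false) n S := by
  set c := f fun _ => false with hc
  let T := Finset.univ.filter fun i => (f fun k => decide (k = i)) ≠ c
  refine ⟨T, funext fun a => ?_⟩
  have key : ∀ S : Finset (Fin n),
      f (fun k => decide (k ∈ S)) = affineSum c n T fun k => decide (k ∈ S) := by
    intro S
    induction S using Finset.induction_on with
    | empty => simp [affineSum, hc]
    | insert i S hi ih =>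
      have e : (fun k => decide (k ∈ insert i S)) =
          fun k => decide (k = i) ^^ decide (k ∈ S) := by
        funext k
        by_cases hk : k = i
        · subst hk; simp [hi]
        · simp [hk]
      have hg := (isPolynomialOp_affineSum c T).isAffine
        (fun k => decide (k = i)) (fun k => decide (k ∈ S))
      rw [e, hf, hg, ih, affineSum_false, ← hc]
      congr 2
      have : affineSum c n T (fun k => decide (k = i)) =
          (c ^^ decide (Odd (if i ∈ T then 1 else 0))) := by
        unfold affineSum
        congr 3
        simp only [decide_eq_true_eq, Finset.filter_eq']
        split_ifs <;> simp
      rw [this]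
      have hiT : i ∈ T ↔ (f fun k => decide (k = i)) ≠ c := by simp [T]
      by_cases h : i ∈ T
      · have := hiT.1 h
        simp only [h, if_true]
        generalize (f fun k => decide (k = i)) = x at *
        generalize c = y at *
        revert this
        cases x <;> cases y <;> simp
      · have := not_not.1 (mt hiT.2 h)
        simp [h, this]
  have := key (Finset.univ.filter fun i => a i = true)
  simpa using this

theorem IsAffine.isPolynomialOp {n : ℕ} {f : Fn Bool Bool n} (hf : IsAffine f) :
    IsPolynomialOp Bool.xor n f := by
  obtain ⟨S, hS⟩ := hf.eq_affineSum
  rw [hS]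
  exact isPolynomialOp_affineSum _ S

/-! ### Functions all of whose identification minors are homomorphisms -/

/-- Only four values are possible, so pigeonhole leaves one exception, in arity exactly 4. -/
theorem exists_eq_or_bijective {n : ℕ} (hn : 4 ≤ n) (u : Fin n → Bool × Bool) :
    (∃ i j, i ≠ j ∧ u i = u j) ∨ Function.Bijective u := by
  by_cases h : Function.Injective u
  · refine Or.inr ((Fintype.bijective_iff_injective_and_card u).2 ⟨h, ?_⟩)
    have := Fintype.card_le_of_injective u h
    simp only [Fintype.card_fin, Fintype.card_prod, Fintype.card_bool] at this ⊢
    omega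
  · simp only [Function.Injective, not_forall] at h
    obtain ⟨i, j, hij, hne⟩ := h
    exact Or.inl ⟨i, j, hne, hij⟩

theorem exists_comp_delta_pair {n : ℕ} {a b : Fin n → Bool} {i j : Fin n} (hij : i ≠ j)
    (ha : a i = a j) (hb : b i = b j) :
    ∃ (I : Couples n) (a' b' : Fin (n - 1) → Bool), a' ∘ delta I = a ∧ b' ∘ delta I = b := by
  obtain ⟨I, ⟨rfl, rfl⟩ | ⟨rfl, rfl⟩⟩ := exists_couple hij
  · obtain ⟨a', ha'⟩ := exists_comp_delta ha
    obtain ⟨b', hb'⟩ := exists_comp_delta hb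
    exact ⟨I, a', b', ha', hb'⟩
  · obtain ⟨a', ha'⟩ := exists_comp_delta ha.symm
    obtain ⟨b', hb'⟩ := exists_comp_delta hb.symm
    exact ⟨I, a', b', ha', hb'⟩

/-- Four indices at which a pair of tuples takes its four values. -/
theorem exists_indices {n : ℕ} {a b : Fin n → Bool}
    (hu : Function.Bijective fun i => (a i, b i)) :
    ∃ p q r s : Fin n, (a p = false ∧ b p = false) ∧ (a q = false ∧ b q = true) ∧
      (a r = true ∧ b r = false) ∧ (a s = true ∧ b s = true) ∧
      (p ≠ q ∧ p ≠ r ∧ p ≠ s ∧ q ≠ r ∧ q ≠ s ∧ r ≠ s) ∧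
      ∀ k, k = p ∨ k = q ∨ k = r ∨ k = s := by
  obtain ⟨p, hp⟩ := hu.2 (false, false)
  obtain ⟨q, hq⟩ := hu.2 (false, true)
  obtain ⟨r, hr⟩ := hu.2 (true, false)
  obtain ⟨s, hs⟩ := hu.2 (true, true)
  have h : ∀ k l, a k = a l → b k = b l → k = l := fun k l h1 h2 => hu.1 (Prod.ext h1 h2)
  simp only [Prod.mk.injEq] at hp hq hr hs
  refine ⟨p, q, r, s, hp, hq, hr, hs, ⟨?_, ?_, ?_, ?_, ?_, ?_⟩, fun k => ?_⟩
  · rintro rfl; simp_all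
  · rintro rfl; simp_all
  · rintro rfl; simp_all
  · rintro rfl; simp_all
  · rintro rfl; simp_all
  · rintro rfl; simp_all
  · cases ha : a k <;> cases hb : b k
    · exact Or.inl (h _ _ (by rw [ha, hp.1]) (by rw [hb, hp.2]))
    · exact Or.inr (Or.inl (h _ _ (by rw [ha, hq.1]) (by rw [hb, hq.2])))
    · exact Or.inr (Or.inr (Or.inl (h _ _ (by rw [ha, hr.1]) (by rw [hb, hr.2]))))
    · exact Or.inr (Or.inr (Or.inr (h _ _ (by rw [ha, hs.1]) (by rw [hb, hs.2]))))

/-- If both tuples agree on a common pair of indices, the identity lives in an identification minor.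
In the exceptional case, `a`, `b` and their meet are written as meets of coatoms, and each meet
taken involves two tuples that are both constant on some pair of indices. -/
theorem isMeetHom_of_identMinor {n : ℕ} (hn : 4 ≤ n) {f : Fn Bool Bool n}
    (h : ∀ I, IsMeetHom (identMinor f I)) : IsMeetHom f := by
  have key : ∀ (a b : Fin n → Bool) (i j : Fin n), i ≠ j → a i = a j → b i = b j →
      f (fun i => a i && b i) = (f a && f b) := by
    intro a b i j hij ha hb
    obtain ⟨I, a, b, rfl, rfl⟩ := exists_comp_delta_pair hij ha hb
    exact h I a b
  intro a b
  rcases exists_eq_or_bijective hn fun i => (a i, b i) with ⟨i, j, hij, hu⟩ | hu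
  · exact key a b i j hij (congrArg Prod.fst hu) (congrArg Prod.snd hu)
  · obtain ⟨p, q, r, s, hp, hq, hr, hs, ⟨n1, n2, n3, n4, n5, n6⟩, hk⟩ := exists_indices hu
    let c : Fin n → Fin n → Bool := fun x k => !decide (k = x)
    have ha : a = fun k => c p k && c q k := by
      funext k
      rcases hk k with rfl | rfl | rfl | rfl <;> simp_all [c, Ne.symm]
    have hb : b = fun k => c p k && c r k := by
      funext k
      rcases hk k with rfl | rfl | rfl | rfl <;> simp_all [c, Ne.symm]
    have hab : (fun k => a k && b k) = fun k => c p k && (c q k && c r k) := by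
      funext k
      rw [ha, hb]
      dsimp only
      cases c p k <;> cases c q k <;> cases c r k <;> rfl
    rw [hab, key (c p) (fun k => c q k && c r k) q r n4 (by simp [c, n1.symm, n2.symm])
        (by simp [c, n4, n4.symm]),
      key (c q) (c r) p s n3 (by simp [c, n1, n5.symm]) (by simp [c, n2, n6.symm]),
      ha, hb, key (c p) (c q) r s n6 (by simp [c, n2.symm, n3.symm])
        (by simp [c, n4.symm, n5.symm]),
      key (c p) (c r) q s n5 (by simp [c, n1.symm, n3.symm]) (by simp [c, n4, n6.symm])]
    cases f (c p) <;> simp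

/-- Affinity has to be checked only at pairs of tuples with disjoint supports. -/
theorem isAffine_of_disjoint {n : ℕ} {f : Fn Bool Bool n}
    (h : ∀ a b : Fin n → Bool, (∀ i, (a i && b i) = false) →
      f (fun i => a i ^^ b i) = (f a ^^ f b ^^ f fun _ => false)) : IsAffine f := by
  intro a b
  have e1 := h (fun i => a i && !b i) (fun i => !a i && b i) fun i => by
    cases a i <;> cases b i <;> rfl
  have e2 := h (fun i => a i && !b i) (fun i => a i && b i) fun i => by
    cases a i <;> cases b i <;> rfl
  have e3 := h (fun i => !a i && b i) (fun i => a i && b i) fun i => by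
    cases a i <;> cases b i <;> rfl
  have h1 : ∀ x y : Bool, ((x && !y) ^^ (!x && y)) = (x ^^ y) := by decide
  have h2 : ∀ x y : Bool, ((x && !y) ^^ (x && y)) = x := by decide
  have h3 : ∀ x y : Bool, ((!x && y) ^^ (x && y)) = y := by decide
  simp only [h1, h2, h3] at e1 e2 e3
  rw [e1]
  change f a = _ at e2
  change f b = _ at e3
  rw [e2, e3]
  generalize f (fun i => a i && !b i) = x1, f (fun i => !a i && b i) = x2,
    f (fun i => a i && b i) = x3, f (fun _ => false) = x4
  revert x1 x2 x3 x4
  decide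

/-- For disjoint supports the pair (1, 1) never occurs, so pigeonhole already succeeds in arity 4.
-/
theorem isAffine_of_identMinor {n : ℕ} (hn : 4 ≤ n) {f : Fn Bool Bool n}
    (h : ∀ I, IsAffine (identMinor f I)) : IsAffine f := by
  refine isAffine_of_disjoint fun a b hab => ?_
  rcases exists_eq_or_bijective hn fun i => (a i, b i) with ⟨i, j, hij, hu⟩ | hu
  · obtain ⟨I, a, b, rfl, rfl⟩ :=
      exists_comp_delta_pair hij (congrArg Prod.fst hu) (congrArg Prod.snd hu)
    exact h I a b
  · obtain ⟨i, hi⟩ := hu.2 (true, true)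
    simp only [Prod.mk.injEq] at hi
    simpa [hi.1, hi.2] using hab i

/-! ### Set-reconstructibility of conjunctions and affine functions -/

/-- A family of functions parametrized by sets of (essential) arguments; identifying two of
these removes `d` of them. -/
structure IsSetFamily (φ : ∀ n : ℕ, Finset (Fin n) → Fn Bool Bool n) (d : ℕ) : Prop where
  image : ∀ {n m : ℕ} (σ : Fin m → Fin n) (T : Finset (Fin m)), Set.InjOn σ T →
    ∀ a, φ m T (a ∘ σ) = φ n (T.image σ) a
  card_le : ∀ {n m : ℕ} {S : Finset (Fin n)} {T : Finset (Fin m)},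
    IsMinor (φ n S) (φ m T) → S.card ≤ T.card
  identMinor : ∀ {n : ℕ} (S : Finset (Fin n)) (I : Couples n), I.1.1 ∈ S → I.1.2 ∈ S →
    ∃ S', identMinor (φ n S) I = φ (n - 1) S' ∧ S'.card + d = S.card

namespace IsSetFamily

variable {φ : ∀ n : ℕ, Finset (Fin n) → Fn Bool Bool n} {d : ℕ}

theorem exists_identMinor (h : IsSetFamily φ d) {n : ℕ} (S : Finset (Fin n)) (I : Couples n) :
    ∃ S', SetRec.identMinor (φ n S) I = φ (n - 1) S' ∧
      ((I.1.1 ∈ S ∧ I.1.2 ∈ S ∧ S'.card + d = S.card) ∨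
        (¬ (I.1.1 ∈ S ∧ I.1.2 ∈ S) ∧ S'.card = S.card)) := by
  by_cases hI : I.1.1 ∈ S ∧ I.1.2 ∈ S
  · obtain ⟨S', h1, h2⟩ := h.identMinor S I hI.1 hI.2
    exact ⟨S', h1, Or.inl ⟨hI.1, hI.2, h2⟩⟩
  · have hinj : Set.InjOn (delta I) S := injOn_delta I hI
    exact ⟨S.image (delta I), funext fun a => h.image _ S hinj a,
      Or.inr ⟨hI, Finset.card_image_of_injOn hinj⟩⟩

theorem equivalent_of_card_eq (h : IsSetFamily φ d) {n : ℕ} {S T : Finset (Fin n)}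
    (hc : S.card = T.card) : Equivalent (φ n S) (φ n T) := by
  have key : ∀ S T : Finset (Fin n), S.card = T.card → IsMinor (φ n S) (φ n T) := by
    intro S T hc
    let e : Equiv.Perm (Fin n) := Equiv.extendSubtype (Finset.equivOfCardEq hc.symm)
    have hS : T.image e = S := by
      apply Finset.eq_of_subset_of_card_le
      · intro x hx
        obtain ⟨t, ht, rfl⟩ := Finset.mem_image.1 hx
        exact Equiv.extendSubtype_mem _ t ht
      · rw [Finset.card_image_of_injective _ e.injective, hc]
    refine ⟨e, fun a => ?_⟩
    rw [h.image e T e.injective.injOn, hS]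
  exact ⟨key S T hc, key T S hc.symm⟩

/-- Suppose `S` is smaller than `T`. If `S` has two elements, identifying them gives a card of size
`S.card - d`, smaller than every card of `T`. Otherwise all cards of `S`, hence of `T`, have size
`S.card`. Then no couple may leave `T` unchanged, so `T` is everything and its cards have size `n -
d`, at least 2: this is where arity 4 is needed. -/
theorem card_le_of_exists (h : IsSetFamily φ d) (hd : d = 1 ∨ d = 2) {n : ℕ} (hn : 4 ≤ n)
    {S T : Finset (Fin n)}
    (h1 : ∀ I, ∃ J : Couples n,
      Equivalent (SetRec.identMinor (φ n S) I) (SetRec.identMinor (φ n T) J))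
    (h2 : ∀ I, ∃ J : Couples n,
      Equivalent (SetRec.identMinor (φ n T) I) (SetRec.identMinor (φ n S) J)) :
    T.card ≤ S.card := by
  have both : ∀ S : Finset (Fin n), 2 ≤ S.card → ∃ I : Couples n, I.1.1 ∈ S ∧ I.1.2 ∈ S := by
    intro S hS
    obtain ⟨i, hi, j, hj, hij⟩ := Finset.one_lt_card.1 hS
    obtain ⟨I, ⟨rfl, rfl⟩ | ⟨rfl, rfl⟩⟩ := exists_couple hij
    exacts [⟨I, hi, hj⟩, ⟨I, hj, hi⟩]
  have nboth : ∀ S : Finset (Fin n), S.card < n →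
      ∃ I : Couples n, ¬ (I.1.1 ∈ S ∧ I.1.2 ∈ S) := by
    intro S hS
    obtain ⟨i, hi⟩ : ∃ i, i ∉ S := by
      by_contra hcon
      push Not at hcon
      have := Finset.eq_univ_of_forall hcon
      simp [this] at hS
    have : Nontrivial (Fin n) := Fin.nontrivial_iff_two_le.2 (by omega)
    obtain ⟨j, hj⟩ := exists_ne i
    obtain ⟨I, ⟨rfl, rfl⟩ | ⟨rfl, rfl⟩⟩ := exists_couple hj
    exacts [⟨I, fun h => hi h.2⟩, ⟨I, fun h => hi h.1⟩]
  have card_eq : ∀ {S T : Finset (Fin (n - 1))},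
      Equivalent (φ (n - 1) S) (φ (n - 1) T) → S.card = T.card :=
    fun he => le_antisymm (h.card_le he.1) (h.card_le he.2)
  by_contra hlt
  push Not at hlt
  by_cases hS : 2 ≤ S.card
  · obtain ⟨I, hI⟩ := both S hS
    obtain ⟨J, hJ⟩ := h1 I
    obtain ⟨S', e1, c1⟩ := h.exists_identMinor S I
    obtain ⟨T', e2, c2⟩ := h.exists_identMinor T J
    rw [e1, e2] at hJ
    have := card_eq hJ
    have c1' := c1.resolve_right fun h => h.1 hI
    omega
  · have hSI : ∀ I : Couples n, ¬ (I.1.1 ∈ S ∧ I.1.2 ∈ S) := fun I hI =>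
      hS (Finset.one_lt_card.2 ⟨_, hI.1, _, hI.2, I.2.ne⟩)
    have hT : ∀ I : Couples n, ∃ T', SetRec.identMinor (φ n T) I = φ (n - 1) T' ∧
        T'.card = S.card := by
      intro I
      obtain ⟨J, hJ⟩ := h2 I
      obtain ⟨T', e1, c1⟩ := h.exists_identMinor T I
      obtain ⟨S', e2, c2⟩ := h.exists_identMinor S J
      refine ⟨T', e1, ?_⟩
      rw [e1, e2] at hJ
      rw [card_eq hJ]
      exact (c2.resolve_left fun h => hSI J ⟨h.1, h.2.1⟩).2
    have card_minor : ∀ {S T : Finset (Fin (n - 1))}, φ (n - 1) S = φ (n - 1) T →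
        S.card = T.card := fun he => card_eq (he ▸ ⟨IsMinor.refl _, IsMinor.refl _⟩)
    have hTn : n ≤ T.card := by
      by_contra hTn
      obtain ⟨I, hI⟩ := nboth T (by omega)
      obtain ⟨T', e1, c1⟩ := hT I
      obtain ⟨T'', e2, c2⟩ := h.exists_identMinor T I
      have := card_minor (e1.symm.trans e2)
      have := (c2.resolve_left fun h => hI ⟨h.1, h.2.1⟩).2
      omega
    obtain ⟨I, hI⟩ := both T (by omega)
    obtain ⟨T', e1, c1⟩ := hT I
    obtain ⟨T'', e2, c2⟩ := h.exists_identMinor T I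
    have := card_minor (e1.symm.trans e2)
    have := c2.resolve_right fun h => h.1 hI
    omega

theorem equivalent (h : IsSetFamily φ d) (hd : d = 1 ∨ d = 2) {n : ℕ} (hn : 4 ≤ n)
    {S T : Finset (Fin n)} (hST : IsSetReconstruction (φ n S) (φ n T)) :
    Equivalent (φ n S) (φ n T) :=
  h.equivalent_of_card_eq <| le_antisymm
    (h.card_le_of_exists hd hn hST.symm.exists_equivalent hST.exists_equivalent)
    (h.card_le_of_exists hd hn hST.exists_equivalent hST.symm.exists_equivalent)

end IsSetFamily

/-! ### Conjunctions and affine sums as set families -/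

theorem conj_comp {n m : ℕ} (σ : Fin m → Fin n) (T : Finset (Fin m)) (a : Fin n → Bool) :
    conj m T (a ∘ σ) = conj n (T.image σ) a := by
  simp [conj]

theorem conj_injective (n : ℕ) : Function.Injective (conj n) := by
  have key : ∀ S T : Finset (Fin n), conj n S = conj n T → S ⊆ T := by
    intro S T h i hi
    have := congrFun h fun k => decide (k ∈ T)
    simp only [conj, decide_eq_true_eq, decide_eq_decide] at this
    exact this.2 (fun _ h => h) i hi
  exact fun S T h => (key S T h).antisymm (key T S h.symm)

theorem isSetFamily_conj : IsSetFamily conj 1 where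
  image σ T _ a := conj_comp σ T a
  card_le := by
    rintro n m S T ⟨σ, hσ⟩
    have : S = T.image σ := conj_injective n (funext fun a => by rw [hσ, conj_comp])
    rw [this]
    exact Finset.card_image_le
  identMinor := by
    intro n S I h1 h2
    have himg : S.image (delta I) = (S.erase I.1.2).image (delta I) := by
      conv_lhs => rw [← Finset.insert_erase h2]
      rw [Finset.image_insert, delta_max, Finset.insert_eq_self]
      exact Finset.mem_image_of_mem _ (Finset.mem_erase.2 ⟨I.2.ne, h1⟩)
    refine ⟨S.image (delta I), funext fun a => conj_comp _ S a, ?_⟩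
    rw [himg, Finset.card_image_of_injOn (injOn_delta I (by simp)), Finset.card_erase_add_one h2]

theorem affineSum_comp_of_injOn (c : Bool) {n m : ℕ} (σ : Fin m → Fin n) (T : Finset (Fin m))
    (hσ : Set.InjOn σ T) (a : Fin n → Bool) :
    affineSum c m T (a ∘ σ) = affineSum c n (T.image σ) a := by
  unfold affineSum
  rw [Finset.filter_image, Finset.card_image_of_injOn]
  · rfl
  · exact hσ.mono fun x hx => (Finset.mem_filter.1 hx).1

theorem affineSum_injective (c : Bool) (n : ℕ) : Function.Injective (affineSum c n) := by
  have hmem : ∀ (S : Finset (Fin n)) (i : Fin n),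
      affineSum c n S (fun k => decide (k = i)) = (c ^^ decide (i ∈ S)) := by
    intro S i
    unfold affineSum
    congr 2
    simp only [decide_eq_true_eq, Finset.filter_eq']
    split_ifs with h <;> simp [h]
  intro S T h
  ext i
  have := congrFun h fun k => decide (k = i)
  rw [hmem, hmem] at this
  simpa using this

/-- Two summands sent to the same index cancel modulo 2, so a new index either enters the set or
removes an element from it. -/
theorem exists_affineSum_comp (c : Bool) {n m : ℕ} (σ : Fin m → Fin n) (T : Finset (Fin m)) :
    ∃ S : Finset (Fin n), S.card ≤ T.card ∧ ∀ a, affineSum c m T (a ∘ σ) = affineSum c n S a := by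
  induction T using Finset.induction_on with
  | empty => exact ⟨∅, le_rfl, fun a => by simp [affineSum_empty]⟩
  | insert i T hi ih =>
    obtain ⟨S, hc, hS⟩ := ih
    rw [Finset.card_insert_of_notMem hi]
    by_cases h : σ i ∈ S
    · refine ⟨S.erase (σ i), (Finset.card_erase_le.trans hc).trans (Nat.le_succ _), fun a => ?_⟩
      rw [affineSum_insert c hi, hS, ← Finset.insert_erase h,
        affineSum_insert c (Finset.notMem_erase _ _), Finset.insert_erase h]
      simp
    · refine ⟨insert (σ i) S, by rw [Finset.card_insert_of_notMem h]; omega, fun a => ?_⟩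
      rw [affineSum_insert c hi, hS, affineSum_insert c h]
      rfl

theorem isSetFamily_affineSum (c : Bool) : IsSetFamily (affineSum c) 2 where
  image := affineSum_comp_of_injOn c
  card_le := by
    rintro n m S T ⟨σ, hσ⟩
    obtain ⟨S', hc, hS'⟩ := exists_affineSum_comp c σ T
    have : S = S' := affineSum_injective c n (funext fun a => by rw [hσ, hS'])
    exact this ▸ hc
  identMinor := by
    intro n S I h1 h2
    have h1' : I.1.1 ∈ S.erase I.1.2 := Finset.mem_erase.2 ⟨I.2.ne, h1⟩
    have hinj : Set.InjOn (delta I) ((S.erase I.1.2).erase I.1.1 : Finset (Fin n)) :=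
      injOn_delta I (by simp)
    refine ⟨((S.erase I.1.2).erase I.1.1).image (delta I), funext fun a => ?_, ?_⟩
    · rw [← affineSum_comp_of_injOn c _ _ hinj, identMinor]
      conv_lhs =>
        rw [← Finset.insert_erase h2, affineSum_insert c (Finset.notMem_erase _ _),
          ← Finset.insert_erase h1', affineSum_insert c (Finset.notMem_erase _ _)]
      simp [delta_max]
    · rw [Finset.card_image_of_injOn hinj, ← Finset.card_erase_add_one h2,
        ← Finset.card_erase_add_one h1']

theorem setReconstructible_of_isMeetHom {n : ℕ} (hn : 4 ≤ n) {f : Fn Bool Bool n}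
    (hf : IsMeetHom f) : SetReconstructible f := by
  intro f' h
  have hf' : IsMeetHom f' := by
    refine isMeetHom_of_identMinor hn fun I => ?_
    obtain ⟨J, hJ⟩ := h.symm.exists_equivalent I
    exact (hf.of_isMinor ⟨delta J, fun a => rfl⟩).of_isMinor hJ.1
  -- A constant tuple stays constant under any substitution, so any single card shows this value.
  have htop : f (fun _ => true) = f' fun _ => true := by
    obtain ⟨J, ⟨σ, hσ⟩, -⟩ := h.exists_equivalent ⟨(⟨0, by omega⟩, ⟨1, by omega⟩), by simp⟩
    exact hσ fun _ => true
  cases hc : f fun _ => true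
  · rw [hf.eq_false hc, hf'.eq_false (htop ▸ hc)]
    exact ⟨IsMinor.refl _, IsMinor.refl _⟩
  · obtain ⟨S, rfl⟩ := hf.eq_conj hc
    obtain ⟨T, rfl⟩ := hf'.eq_conj (htop ▸ hc)
    exact isSetFamily_conj.equivalent (Or.inl rfl) hn h

theorem setReconstructible_of_isAffine {n : ℕ} (hn : 4 ≤ n) {f : Fn Bool Bool n}
    (hf : IsAffine f) : SetReconstructible f := by
  intro f' h
  have hf' : IsAffine f' := by
    refine isAffine_of_identMinor hn fun I => ?_
    obtain ⟨J, hJ⟩ := h.symm.exists_equivalent I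
    exact (hf.of_isMinor ⟨delta J, fun a => rfl⟩).of_isMinor hJ.1
  have hbot : f (fun _ => false) = f' fun _ => false := by
    obtain ⟨J, ⟨σ, hσ⟩, -⟩ := h.exists_equivalent ⟨(⟨0, by omega⟩, ⟨1, by omega⟩), by simp⟩
    exact hσ fun _ => false
  obtain ⟨S, hS⟩ := hf.eq_affineSum
  obtain ⟨T, hT⟩ := hf'.eq_affineSum
  rw [← hbot] at hT
  rw [hS, hT] at h ⊢
  exact (isSetFamily_affineSum _).equivalent (Or.inr rfl) hn h

theorem SetReconstructible.of_dual {n : ℕ} {f : Fn Bool Bool n}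
    (hf : SetReconstructible (dual f)) : SetReconstructible f :=
  fun _ h => (hf _ h.dual).of_dual

theorem IsPolynomialOp.dual_or {n : ℕ} {f : Fn Bool Bool n} (h : IsPolynomialOp Bool.or n f) :
    IsPolynomialOp Bool.and n (dual f) := by
  induction h with
  | proj i =>
    have : dual (fun a : Fin n → Bool => a i) = fun a => a i := by
      funext a
      simp [dual]
    rw [this]
    exact .proj i
  | const c => exact .const (!c)
  | app f g _ _ hf hg =>
    have : dual (fun a => Bool.or (f a) (g a)) = fun a => Bool.and (dual f a) (dual g a) := by
      funext a
      exact Bool.not_or _ _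
    rw [this]
    exact .app _ _ hf hg

theorem IsPolynomialOp.dual_and {n : ℕ} {f : Fn Bool Bool n} (h : IsPolynomialOp Bool.and n f) :
    IsPolynomialOp Bool.or n (dual f) := by
  induction h with
  | proj i =>
    have : dual (fun a : Fin n → Bool => a i) = fun a => a i := by
      funext a
      simp [dual]
    rw [this]
    exact .proj i
  | const c => exact .const (!c)
  | app f g _ _ hf hg =>
    have : dual (fun a => Bool.and (f a) (g a)) = fun a => Bool.or (dual f a) (dual g a) := by
      funext a
      exact Bool.not_and _ _
    rw [this]
    exact .app _ _ hf hg

theorem setReconstructible_of_inLambdaVL {C : FnClass Bool Bool} (h : InLambdaVL C) :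
    (C.arityGE 4).SetReconstructible := by
  rintro n f ⟨hn, hf⟩
  rcases h with h | h | h
  · exact setReconstructible_of_isMeetHom hn (h n hf).2.isMeetHom
  · exact (setReconstructible_of_isMeetHom hn (h n hf).2.dual_or.isMeetHom).of_dual
  · exact setReconstructible_of_isAffine hn (h n hf).2.isAffine

/-! ### Clones not included in `Λ`, `V` or `L` -/

/-- The operation `x ∧ (y ∨ z)`. -/
def andOr : Fn Bool Bool 3 := fun v => v 0 && (v 1 || v 2)

/-- The operation `x ∧ y`. -/
def andOp : Fn Bool Bool 2 := fun v => v 0 && v 1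

/-- The operation `x ∨ y`. -/
def orOp : Fn Bool Bool 2 := fun v => v 0 || v 1

/-- The majority operation. -/
def majOp : Fn Bool Bool 3 := fun v => (v 0 && v 1) || (v 0 && v 2) || (v 1 && v 2)

namespace IsClone

variable {C : FnClass Bool Bool}

theorem comp₂ (hC : IsClone C) {m : ℕ} {f : Fn Bool Bool 2} (hf : f ∈ C 2)
    {g h : Fn Bool Bool m} (hg : g ∈ C m) (hh : h ∈ C m) :
    (fun a => f ![g a, h a]) ∈ C m := by
  have := hC.comp 2 m f ![g, h] hf fun i => by fin_cases i <;> assumption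
  convert this using 3 with a
  funext i
  fin_cases i <;> rfl

theorem comp₃ (hC : IsClone C) {m : ℕ} {f : Fn Bool Bool 3} (hf : f ∈ C 3)
    {g h k : Fn Bool Bool m} (hg : g ∈ C m) (hh : h ∈ C m) (hk : k ∈ C m) :
    (fun a => f ![g a, h a, k a]) ∈ C m := by
  have := hC.comp 3 m f ![g, h, k] hf fun i => by fin_cases i <;> assumption
  convert this using 3 with a
  funext i
  fin_cases i <;> rfl

/-- Replacement of a function by one with the same values. -/
theorem mem_of_forall_eq {n : ℕ} {f g : Fn Bool Bool n} (hf : f ∈ C n) (h : ∀ a, g a = f a) :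
    g ∈ C n := (funext h : g = f) ▸ hf

theorem forall_fin_three {p : (Fin 3 → Bool) → Prop} :
    (∀ v, p v) ↔ ∀ x y z, p ![x, y, z] := by
  refine ⟨fun h x y z => h _, fun h v => ?_⟩
  have : v = ![v 0, v 1, v 2] := by
    funext i
    fin_cases i <;> rfl
  rw [this]
  exact h _ _ _

theorem forall_fin_two {p : (Fin 2 → Bool) → Prop} :
    (∀ v, p v) ↔ ∀ x y, p ![x, y] := by
  refine ⟨fun h x y => h _, fun h v => ?_⟩
  have : v = ![v 0, v 1] := by
    funext i
    fin_cases i <;> rfl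
  rw [this]
  exact h _ _

/-! ### From conjunction and a function that is no meet-homomorphism to x ∧ (y ∨ z) -/

theorem andOr_mem_of_andNot (hC : IsClone C)
    (h : (fun v : Fin 2 → Bool => v 0 && !v 1) ∈ C 2) : andOr ∈ C 3 := by
  -- This is x ∧ ¬y ∧ ¬z; removing it from x leaves x ∧ (y ∨ z).
  have h1 := hC.comp₂ h (hC.comp₂ h (hC.proj 3 0) (hC.proj 3 1)) (hC.proj 3 2)
  refine mem_of_forall_eq (hC.comp₂ h (hC.proj 3 0) h1) (forall_fin_three.2 ?_)
  decide

/-- From `∧` and `x ∧ k(y, z)` with `k(0, 0) = 1`, `k(1, 0) = 0`. -/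
theorem andOr_mem_of_decreasing (hC : IsClone C) (hand : andOp ∈ C 2) {k : Bool → Bool → Bool}
    (hk : (fun v : Fin 3 → Bool => v 0 && k (v 1) (v 2)) ∈ C 3)
    (h00 : k false false = true) (h10 : k true false = false) : andOr ∈ C 3 := by
  have p0 := hC.proj 2 0
  have p1 := hC.proj 2 1
  have q0 := hC.proj 3 0
  have q1 := hC.proj 3 1
  have q2 := hC.proj 3 2
  -- Below x, which plays the role of the constant 1, disjunction comes from implication: y ∨ z = (z
  -- → y) → y.
  have implies : (fun v : Fin 3 → Bool => v 0 && (v 2 || !v 1)) ∈ C 3 → andOr ∈ C 3 := by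
    intro h
    refine mem_of_forall_eq (hC.comp₃ h q0 (hC.comp₃ h q0 q2 q1) q1) (forall_fin_three.2 ?_)
    decide
  cases h11 : k true true
  · refine hC.andOr_mem_of_andNot (mem_of_forall_eq (hC.comp₃ hk p0 p1 (hC.comp₂ hand p0 p1)) ?_)
    refine forall_fin_two.2 ?_
    intro x y
    cases x <;> cases y <;> simp [andOp, h00, h11]
  · refine implies (mem_of_forall_eq (hC.comp₃ hk q0 q1
      (hC.comp₂ hand q0 (hC.comp₂ hand q1 q2))) (forall_fin_three.2 ?_))
    intro x y z
    cases x <;> cases y <;> cases z <;> simp [andOp, h00, h10, h11]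

/-- From `x ∧ k(y, z)` with `k(0, 0) = 0`, `k(1, 0) = k(0, 1) = 1`. -/
theorem andOr_mem_of_or (hC : IsClone C) {k : Bool → Bool → Bool}
    (hk : (fun v : Fin 3 → Bool => v 0 && k (v 1) (v 2)) ∈ C 3)
    (h00 : k false false = false) (h10 : k true false = true) (h01 : k false true = true) :
    andOr ∈ C 3 := by
  cases h11 : k true true
  · refine hC.andOr_mem_of_andNot (mem_of_forall_eq
      (hC.comp₃ hk (hC.proj 2 0) (hC.proj 2 0) (hC.proj 2 1)) ?_)
    refine forall_fin_two.2 ?_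
    intro x y
    cases x <;> cases y <;> simp [h10, h11]
  · refine mem_of_forall_eq hk (forall_fin_three.2 ?_)
    intro x y z
    cases x <;> cases y <;> cases z <;> simp [andOr, h00, h10, h01, h11]

/-- The failure has two forms: `f` is not monotone, or it is true at two tuples and false at their
meet. Substituting variables according to the values of `a` and `b`, and conjoining with x to
replace the constant 1, leads to the two preceding lemmas. -/
theorem andOr_mem_of_not_isMeetHom (hC : IsClone C) (hand : andOp ∈ C 2) {n : ℕ}
    {f : Fn Bool Bool n} (hf : f ∈ C n) (h : ¬ IsMeetHom f) : andOr ∈ C 3 := by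
  have q0 := hC.proj 3 0
  have q1 := hC.proj 3 1
  have q2 := hC.proj 3 2
  have hmono : ∀ a b : Fin n → Bool, f (fun i => a i && b i) = true → f a = false →
      andOr ∈ C 3 := by
    intro a b hab ha
    let g : Bool → Bool → Bool → Bool := fun x y z => f fun i => bif a i then
      (bif b i then x else y) else z
    have hg : (fun v : Fin 3 → Bool => g (v 0) (v 1) (v 2)) ∈ C 3 := by
      refine hC.comp n 3 f (fun i v => bif a i then (bif b i then v 0 else v 1) else v 2) hf
        fun i => ?_
      cases a i <;> cases b i <;> assumption
    refine hC.andOr_mem_of_decreasing hand (k := fun y z => g true y z)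
      (mem_of_forall_eq (hC.comp₂ hand q0 hg) fun v => ?_) ?_ ?_
    · simp only [andOp]
      cases v 0 <;> simp
    · refine Eq.trans (congrArg f (funext fun i => ?_)) hab
      cases a i <;> cases b i <;> rfl
    · refine Eq.trans (congrArg f (funext fun i => ?_)) ha
      cases a i <;> cases b i <;> rfl
  simp only [IsMeetHom, not_forall] at h
  obtain ⟨a, b, hab⟩ := h
  cases h0 : f fun i => a i && b i
  · rw [h0] at hab
    have ha : f a = true := by
      cases ha : f a
      · simp [ha] at hab
      · rfl
    have hb : f b = true := by
      cases hb : f b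
      · simp [hb] at hab
      · rfl
    let g : Bool → Bool → Bool → Bool → Bool := fun x y z w => f fun i => bif a i then
      (bif b i then x else y) else (bif b i then z else w)
    -- The constant 0 may be unavailable; x ∧ y ∧ z replaces it, since it vanishes at the three
    -- evaluations that matter.
    have hw := hC.comp₂ hand q0 (hC.comp₂ hand q1 q2)
    have hg : (fun v : Fin 3 → Bool => g (v 0) (v 1) (v 2) (v 0 && (v 1 && v 2))) ∈ C 3 := by
      refine hC.comp n 3 f (fun i v => bif a i then (bif b i then v 0 else v 1) else
        (bif b i then v 2 else v 0 && (v 1 && v 2))) hf fun i => ?_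
      cases a i <;> cases b i <;> assumption
    refine hC.andOr_mem_of_or (k := fun y z => g true y z (y && z))
      (mem_of_forall_eq (hC.comp₂ hand q0 hg) fun v => ?_) ?_ ?_ ?_
    · simp only [andOp]
      cases v 0 <;> simp
    · refine Eq.trans (congrArg f (funext fun i => ?_)) h0
      cases a i <;> cases b i <;> rfl
    · refine Eq.trans (congrArg f (funext fun i => ?_)) ha
      cases a i <;> cases b i <;> rfl
    · refine Eq.trans (congrArg f (funext fun i => ?_)) hb
      cases a i <;> cases b i <;> rfl
  · cases ha : f a
    · exact hmono a b h0 ha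
    · cases hb : f b
      · exact hmono b a (by simpa only [Bool.and_comm] using h0) hb
      · simp [h0, ha, hb] at hab

/-! ### From a non-affine function to conjunction, disjunction or majority -/

theorem and_or_of_odd : ∀ q : Bool → Bool → Bool,
    (q false false ^^ q true false ^^ q false true ^^ q true true) = true →
    ((∀ x y, (x && y) = q x y) ∨ (∀ x y, (x && y) = q x (q x y)) ∨
      (∀ x y, (x && y) = q (q x y) y) ∨ (∀ x y, (x && y) = q (q x y) (q x y))) ∨
    ((∀ x y, (x || y) = q x y) ∨ (∀ x y, (x || y) = q x (q x y)) ∨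
      (∀ x y, (x || y) = q (q x y) y) ∨ (∀ x y, (x || y) = q (q x y) (q x y))) := by
  decide

/-- A binary operation of odd weight generates `∧` or `∨`. -/
theorem and_or_mem_of_odd (hC : IsClone C) {q : Bool → Bool → Bool}
    (hq : (fun v : Fin 2 → Bool => q (v 0) (v 1)) ∈ C 2)
    (h : (q false false ^^ q true false ^^ q false true ^^ q true true) = true) :
    andOp ∈ C 2 ∨ orOp ∈ C 2 := by
  have p0 := hC.proj 2 0
  have p1 := hC.proj 2 1
  have c2 := hC.comp₂ hq p0 hq
  have c3 := hC.comp₂ hq hq p1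
  have c4 := hC.comp₂ hq hq hq
  rcases and_or_of_odd q h with (h | h | h | h) | (h | h | h | h)
  exacts [Or.inl (mem_of_forall_eq hq fun v => h _ _), Or.inl (mem_of_forall_eq c2 fun v => h _ _),
    Or.inl (mem_of_forall_eq c3 fun v => h _ _), Or.inl (mem_of_forall_eq c4 fun v => h _ _),
    Or.inr (mem_of_forall_eq hq fun v => h _ _), Or.inr (mem_of_forall_eq c2 fun v => h _ _),
    Or.inr (mem_of_forall_eq c3 fun v => h _ _), Or.inr (mem_of_forall_eq c4 fun v => h _ _)]

/-- The sum of the majority operation and an affine function. -/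
def majAdd (α β γ δ x y z : Bool) : Bool :=
  ((x && y) || (x && z) || (y && z)) ^^ (α && x) ^^ (β && y) ^^ (γ && z) ^^ δ

/-- Consider the polynomial of `g` modulo 2. The first hypothesis makes the coefficient of yz equal
to 1. The other three say that no binary identification minor has a quadratic term, which forces the
coefficients of xy and xz to be 1 and that of xyz to be 0. -/
theorem eq_majAdd {g : Bool → Bool → Bool → Bool}
    (h : (g false false false ^^ g false true false ^^ g false false true ^^
      g false true true) = true)
    (h1 : (g false false false ^^ g true true false ^^ g false false true ^^
      g true true true) = false)
    (h2 : (g false false false ^^ g true false true ^^ g false true false ^^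
      g true true true) = false)
    (h3 : (g false false false ^^ g true false false ^^ g false true true ^^
      g true true true) = false) :
    ∃ α β γ δ, g = majAdd α β γ δ := by
  refine ⟨g true false false ^^ g false false false, g false true false ^^ g false false false,
    g false false true ^^ g false false false, g false false false, ?_⟩
  funext x y z
  revert h h1 h2 h3
  cases x <;> cases y <;> cases z <;>
    generalize g false false false = t0, g false false true = t1, g false true false = t2,
      g false true true = t3, g true false false = t4, g true false true = t5,
      g true true false = t6, g true true true = t7 <;>
    revert t0 t1 t2 t3 t4 t5 t6 t7 <;> decide

/-- If α + β + γ is even, g(k, k, k) = k + δ, so negation is available when δ = 1. If all three are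
1, g(k, l, l) = k + l + δ adds arguments back. In the other cases, substituting `g` into itself
cancels the affine part. -/
theorem majOp_mem_of_majAdd (hC : IsClone C) {α β γ δ : Bool}
    (hg : (fun v : Fin 3 → Bool => majAdd α β γ δ (v 0) (v 1) (v 2)) ∈ C 3) : majOp ∈ C 3 := by
  have q0 := hC.proj 3 0
  have q1 := hC.proj 3 1
  have q2 := hC.proj 3 2
  have neg : ∀ {k : Fn Bool Bool 3}, k ∈ C 3 → _ := fun {k} hk => hC.comp₃ hg hk hk hk
  have add : ∀ {k l : Fn Bool Bool 3}, k ∈ C 3 → l ∈ C 3 → _ :=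
    fun {k l} hk hl => hC.comp₃ hg hk hl hl
  cases α <;> cases β <;> cases γ
  · cases δ
    · exact mem_of_forall_eq hg (forall_fin_three.2 (by decide))
    · exact mem_of_forall_eq (neg hg) (forall_fin_three.2 (by decide))
  · cases δ <;> exact mem_of_forall_eq (hC.comp₃ hg q2 q2 hg) (forall_fin_three.2 (by decide))
  · cases δ <;> exact mem_of_forall_eq (hC.comp₃ hg q1 hg q1) (forall_fin_three.2 (by decide))
  · cases δ
    · exact mem_of_forall_eq (hC.comp₃ hg hg q1 q2) (forall_fin_three.2 (by decide))
    · exact mem_of_forall_eq (hC.comp₃ hg q0 (neg q1) (neg q2)) (forall_fin_three.2 (by decide))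
  · cases δ <;> exact mem_of_forall_eq (hC.comp₃ hg hg q0 q0) (forall_fin_three.2 (by decide))
  · cases δ
    · exact mem_of_forall_eq (hC.comp₃ hg q0 hg q2) (forall_fin_three.2 (by decide))
    · exact mem_of_forall_eq (hC.comp₃ hg (neg q0) q1 (neg q2)) (forall_fin_three.2 (by decide))
  · cases δ
    · exact mem_of_forall_eq (hC.comp₃ hg q0 q1 hg) (forall_fin_three.2 (by decide))
    · exact mem_of_forall_eq (hC.comp₃ hg (neg q0) (neg q1) q2) (forall_fin_three.2 (by decide))
  · cases δ <;>
      exact mem_of_forall_eq (add (add (add hg q0) q1) q2) (forall_fin_three.2 (by decide))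

/-- A failure of affinity at disjoint supports yields a ternary `g` with g(0, y, z) of odd weight.
Identifying two arguments either gives a binary operation of odd weight or, if all three weights are
even, `g` is majority plus an affine function. -/
theorem and_or_maj_mem_of_not_isAffine (hC : IsClone C) {n : ℕ} {f : Fn Bool Bool n}
    (hf : f ∈ C n) (h : ¬ IsAffine f) : andOp ∈ C 2 ∨ orOp ∈ C 2 ∨ majOp ∈ C 3 := by
  obtain ⟨a, b, hdisj, hab⟩ : ∃ a b : Fin n → Bool, (∀ i, (a i && b i) = false) ∧
      f (fun i => a i ^^ b i) ≠ (f a ^^ f b ^^ f fun _ => false) := by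
    by_contra hcon
    push Not at hcon
    exact h (isAffine_of_disjoint hcon)
  let g : Bool → Bool → Bool → Bool := fun x y z => f fun i => bif a i then y else
    bif b i then z else x
  have hg : (fun v : Fin 3 → Bool => g (v 0) (v 1) (v 2)) ∈ C 3 := by
    refine hC.comp n 3 f (fun i v => bif a i then v 1 else bif b i then v 2 else v 0) hf
      fun i => ?_
    cases a i <;> cases b i <;> exact hC.proj 3 _
  have e0 : g false false false = f fun _ => false := congrArg f (funext fun i => by simp)
  have e1 : g false true false = f a := congrArg f (funext fun i => by simp)
  have e2 : g false false true = f b := congrArg f (funext fun i => by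
    have := hdisj i
    revert this
    cases a i <;> cases b i <;> simp)
  have e3 : g false true true = f fun i => a i ^^ b i := congrArg f (funext fun i => by
    have := hdisj i
    revert this
    cases a i <;> cases b i <;> simp)
  have hodd : (g false false false ^^ g false true false ^^ g false false true ^^
      g false true true) = true := by
    rw [e0, e1, e2, e3]
    revert hab
    generalize f (fun _ => false) = x1, f a = x2, f b = x3, f (fun i => a i ^^ b i) = x4
    revert x1 x2 x3 x4
    decide
  clear_value g
  have p0 := hC.proj 2 0
  have p1 := hC.proj 2 1
  have m1 : (fun v : Fin 2 → Bool => g (v 0) (v 0) (v 1)) ∈ C 2 := hC.comp₃ hg p0 p0 p1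
  have m2 : (fun v : Fin 2 → Bool => g (v 0) (v 1) (v 0)) ∈ C 2 := hC.comp₃ hg p0 p1 p0
  have m3 : (fun v : Fin 2 → Bool => g (v 0) (v 1) (v 1)) ∈ C 2 := hC.comp₃ hg p0 p1 p1
  by_cases h1 : (g false false false ^^ g true true false ^^ g false false true ^^
      g true true true) = true
  · exact (hC.and_or_mem_of_odd (q := fun x y => g x x y) m1 h1).imp_right Or.inl
  by_cases h2 : (g false false false ^^ g true false true ^^ g false true false ^^
      g true true true) = true
  · exact (hC.and_or_mem_of_odd (q := fun x y => g x y x) m2 h2).imp_right Or.inl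
  by_cases h3 : (g false false false ^^ g true false false ^^ g false true true ^^
      g true true true) = true
  · exact (hC.and_or_mem_of_odd (q := fun x y => g x y y) m3 h3).imp_right Or.inl
  rw [Bool.not_eq_true] at h1 h2 h3
  obtain ⟨α, β, γ, δ, rfl⟩ := eq_majAdd hodd h1 h2 h3
  exact Or.inr (Or.inr (hC.majOp_mem_of_majAdd hg))

/-- A clone not included in `Λ`, `V` or `L` contains `x ∧ (y ∨ z)`, its dual, or majority. -/
theorem andOr_or_majOp_mem (hC : IsClone C) (h : ¬ InLambdaVL C) :
    andOr ∈ C 3 ∨ andOr ∈ SetRec.dualClass C 3 ∨ majOp ∈ C 3 := by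
  simp only [InLambdaVL, not_or, not_forall, Set.not_subset] at h
  obtain ⟨⟨n1, f1, hf1, h1⟩, ⟨n2, f2, hf2, h2⟩, ⟨n3, f3, hf3, h3⟩⟩ := h
  have h1' : ¬ IsMeetHom f1 := fun h => h1 ⟨hC.pos _ _ hf1, h.isPolynomialOp⟩
  have h2' : ¬ IsMeetHom (SetRec.dual f2) := fun h =>
    h2 ⟨hC.pos _ _ hf2, by simpa using h.isPolynomialOp.dual_and⟩
  have h3' : ¬ IsAffine f3 := fun h => h3 ⟨hC.pos _ _ hf3, h.isPolynomialOp⟩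
  rcases hC.and_or_maj_mem_of_not_isAffine hf3 h3' with h | h | h
  · exact Or.inl (hC.andOr_mem_of_not_isMeetHom h hf1 h1')
  · refine Or.inr (Or.inl (hC.dualClass.andOr_mem_of_not_isMeetHom (f := SetRec.dual f2) ?_ ?_ h2'))
    · change SetRec.dual _ ∈ C 2
      have : SetRec.dual andOp = orOp := by
        funext v
        simp [SetRec.dual, andOp, orOp]
      rwa [this]
    · change SetRec.dual _ ∈ C n2
      rwa [dual_dual]
  · exact Or.inr (Or.inr h)

end IsClone

/-! ### Functions with arguments indexed by a finite type -/

section Index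

variable {P : Type} {n : ℕ}

/-- The `n`-ary function obtained from an enumeration of the index set. -/
def ofIndex (e : P ≃ Fin n) (F : (P → Bool) → Bool) : Fn Bool Bool n := fun a => F (a ∘ e)

/-- Any two arguments have a fixing permutation that turns `F` into `G` on the tuples in which
they agree. -/
def FixingHypomorphic (F G : (P → Bool) → Bool) : Prop :=
  ∀ u v : P, u ≠ v → ∃ ρ : Equiv.Perm P, ρ u = u ∧ ρ v = v ∧
    ∀ a : P → Bool, a u = a v → F a = G (a ∘ ρ)

theorem FixingHypomorphic.stronglyHypomorphic {F G : (P → Bool) → Bool}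
    (h : FixingHypomorphic F G) (e : P ≃ Fin n) :
    StronglyHypomorphic (ofIndex e F) (ofIndex e G) := by
  intro I
  obtain ⟨ρ, h1, h2, hρ⟩ := h (e.symm I.1.1) (e.symm I.1.2) fun he => I.2.ne (e.symm.injective he)
  refine equivalent_identMinor_of_perm I ((e.symm.trans ρ).trans e) (by simp [h1]) (by simp [h2])
    fun a ha => ?_
  unfold ofIndex
  rw [hρ (a ∘ e) (by simpa using ha)]
  congr 1
  funext p
  simp

theorem exists_of_equivalent_ofIndex {F G : (P → Bool) → Bool} {e : P ≃ Fin n}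
    (h : Equivalent (ofIndex e F) (ofIndex e G)) : ∃ σ : P → P, ∀ a, F a = G (a ∘ σ) := by
  obtain ⟨⟨σ, hσ⟩, -⟩ := h
  refine ⟨e.symm ∘ σ ∘ e, fun a => ?_⟩
  have := hσ (a ∘ e.symm)
  unfold ofIndex at this
  convert this using 2
  · funext p
    simp
  · funext p
    simp

/-- A substitution of arguments in a function depending on all of its arguments is a
permutation. -/
theorem bijective_of_essential [Finite P] {F G : (P → Bool) → Bool} {σ : P → P}
    (hσ : ∀ a, F a = G (a ∘ σ))
    (h : ∀ p, ∃ a b : P → Bool, (∀ q, q ≠ p → a q = b q) ∧ F a ≠ F b) :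
    Function.Bijective σ := by
  refine Function.Surjective.bijective_of_finite fun p => ?_
  by_contra hp
  obtain ⟨a, b, hab, hF⟩ := h p
  refine hF ?_
  rw [hσ, hσ]
  congr 1
  funext q
  exact hab _ fun hq => hp ⟨q, hq⟩

/-- Monotone functions are obtained from the projections and the constant `1` by means of `∧`
and `∨`. -/
theorem monotone_induction [Finite P] {R : ((P → Bool) → Bool) → Prop}
    (hproj : ∀ p, R fun a => a p) (htop : R fun _ => true)
    (hand : ∀ F G, R F → R G → R fun a => F a && G a)
    (hor : ∀ F G, R F → R G → R fun a => F a || G a) {F : (P → Bool) → Bool} (hF : Monotone F)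
    (h1 : F (fun _ => true) = true) : R F := by
  classical
  cases nonempty_fintype P
  let c : (P → Bool) → (P → Bool) → Bool := fun b =>
    (Finset.univ.filter fun p => b p = true).inf fun p a => a p
  let T := Finset.univ.filter fun b => F b = true
  have hT : T.Nonempty := ⟨fun _ => true, by simp [T, h1]⟩
  have hc : ∀ b, R (c b) := fun b =>
    Finset.inf_induction (p := R) htop (fun F hF G hG => hand F G hF hG) fun p _ => hproj p
  have hca : ∀ a b, c b a = true ↔ b ≤ a := by
    intro a b
    have top_eq : (⊤ : Bool) = true := rfl
    simp only [c, Finset.inf_apply]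
    rw [← top_eq, Finset.inf_eq_top_iff]
    simp only [Finset.mem_filter, Finset.mem_univ, true_and]
    exact Iff.rfl
  -- Disjunctive normal form over all true points; `h1` makes the disjunction nonempty, so the
  -- constant 0 is not needed.
  have hFs : F = T.sup' hT c := by
    funext a
    rw [Finset.sup'_apply, Bool.eq_iff_iff]
    constructor
    · intro ha
      have : c a a ≤ T.sup' hT fun b => c b a :=
        Finset.le_sup' (fun b => c b a) (by simp [T, ha])
      rw [(hca a a).2 le_rfl] at this
      exact this rfl
    · intro ha
      obtain ⟨b, hb, hb'⟩ := Finset.exists_mem_eq_sup' hT fun b => c b a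
      rw [hb', hca] at ha
      exact hF ha (Finset.mem_filter.1 hb).2
  rw [hFs]
  exact Finset.sup'_induction hT c (fun F hF G hG => hor F G hF hG) fun b _ => hc b

end Index

/-! ### A pair of monotone functions differing by a parity -/

section Cyclic

open Classical

variable {ι : Type}

/-- Exchange of the two elements of a block. -/
noncomputable def swapBlock (r : ι) : Equiv.Perm (ι × Bool) :=
  Function.Involutive.toPerm (fun q => (q.1, if q.1 = r then !q.2 else q.2)) fun q => by
    by_cases h : q.1 = r <;> ext <;> simp [h]

theorem swapBlock_of_ne {r i : ι} (h : i ≠ r) (β : Bool) : swapBlock r (i, β) = (i, β) := by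
  simp [swapBlock, Function.Involutive.toPerm, h]

theorem swapBlock_self (r : ι) (β : Bool) : swapBlock r (r, β) = (r, !β) := by
  simp [swapBlock, Function.Involutive.toPerm]

theorem swapBlock_swapBlock (r : ι) (q : ι × Bool) : swapBlock r (swapBlock r q) = q :=
  Function.Involutive.toPerm_involutive _ q

variable (s : Equiv.Perm ι)

/-- The common part of the two functions: the block of `s i` is full, and the block of `i`
contributes its first element, or its second element together with an element of some third
block. -/
def CycleTrue (a : ι × Bool → Bool) : Prop :=
  ∃ i, a (s i, false) = true ∧ a (s i, true) = true ∧
    (a (i, false) = true ∨ (a (i, true) = true ∧ ∃ c, c ≠ i ∧ c ≠ s i ∧ ∃ β, a (c, β) = true))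

/-- `a` is a transversal of the blocks with a prescribed parity of second elements. -/
def IsParityTransversal [Fintype ι] (ε : Bool) (a : ι × Bool → Bool) : Prop :=
  (∀ i, a (i, true) = !a (i, false)) ∧
    decide (Odd (Finset.univ.filter fun i => a (i, true) = true).card) = ε

/-- The pair of monotone functions (for `ε = 0, 1`) on `2m` points in `m` blocks. -/
noncomputable def parityFn [Fintype ι] (ε : Bool) (a : ι × Bool → Bool) : Bool :=
  decide (CycleTrue s a ∨ IsParityTransversal ε a)

theorem IsParityTransversal.comp_swapBlock [Fintype ι] {ε : Bool} {a : ι × Bool → Bool} (r : ι)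
    (h : IsParityTransversal ε a) : IsParityTransversal (!ε) (a ∘ swapBlock r) := by
  obtain ⟨h1, h2⟩ := h
  refine ⟨fun i => ?_, ?_⟩
  · by_cases hi : i = r
    · subst hi
      simp [swapBlock_self, h1]
    · simp [swapBlock_of_ne hi, h1]
  · rw [← h2, ← decide_not, decide_eq_decide]
    cases hr : a (r, true)
    · have hr' : a (r, false) = true := by simpa [hr] using h1 r
      have : (Finset.univ.filter fun i => (a ∘ swapBlock r) (i, true) = true) =
          insert r (Finset.univ.filter fun i => a (i, true) = true) := by
        ext i
        by_cases hi : i = r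
        · subst hi
          simp [swapBlock_self, hr']
        · simp [swapBlock_of_ne hi, hi]
      rw [this, Finset.card_insert_of_notMem (by simp [hr]), Nat.odd_add_one]
    · have hr' : a (r, false) = false := by simpa [hr] using h1 r
      have : (Finset.univ.filter fun i => a (i, true) = true) =
          insert r (Finset.univ.filter fun i => (a ∘ swapBlock r) (i, true) = true) := by
        ext i
        by_cases hi : i = r
        · subst hi
          simp [hr]
        · simp [swapBlock_of_ne hi, hi]
      rw [this, Finset.card_insert_of_notMem (by simp [swapBlock_self, hr']), Nat.odd_add_one,
        not_not]

/-- If the block of `s r` is full, then there is an element outside of the blocks of `r`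
and `s r`. -/
def Escapes (r : ι) (a : ι × Bool → Bool) : Prop :=
  a (s r, false) = true → a (s r, true) = true → ∃ c, c ≠ r ∧ c ≠ s r ∧ ∃ β, a (c, β) = true

variable {s}

theorem exists_comp_swapBlock {a : ι × Bool → Bool} (r c : ι) (h : ∃ β, a (c, β) = true) :
    ∃ β, (a ∘ swapBlock r) (c, β) = true := by
  obtain ⟨β, hβ⟩ := h
  by_cases hc : c = r
  · subst hc
    exact ⟨!β, by simpa [swapBlock_self] using hβ⟩
  · exact ⟨β, by simpa [swapBlock_of_ne hc] using hβ⟩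

/-- The two clauses for the block of `i` differ only by the demand for a third block. The exchange
interchanges them when `i = r`, where `Escapes` supplies that block; for other `i` nothing essential
changes. -/
theorem CycleTrue.comp_swapBlock {a : ι × Bool → Bool} {r : ι}
    (hr : Escapes s r a) (h : CycleTrue s a) : CycleTrue s (a ∘ swapBlock r) := by
  obtain ⟨i, h2, h3, h4⟩ := h
  refine ⟨i, ?_, ?_, ?_⟩
  · by_cases hi : s i = r
    · simpa [hi, swapBlock_self] using hi ▸ h3
    · simpa [swapBlock_of_ne hi] using h2
  · by_cases hi : s i = r
    · simpa [hi, swapBlock_self] using hi ▸ h2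
    · simpa [swapBlock_of_ne hi] using h3
  · by_cases hi : i = r
    · subst hi
      rcases h4 with h4 | ⟨h4, -⟩
      · obtain ⟨c, hc1, hc2, hc⟩ := hr h2 h3
        exact Or.inr ⟨by simpa [swapBlock_self] using h4, c, hc1, hc2,
          exists_comp_swapBlock i c hc⟩
      · exact Or.inl (by simpa [swapBlock_self] using h4)
    · rcases h4 with h4 | ⟨h4, c, hc1, hc2, hc⟩
      · exact Or.inl (by simpa [swapBlock_of_ne hi] using h4)
      · exact Or.inr ⟨by simpa [swapBlock_of_ne hi] using h4, c, hc1, hc2,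
          exists_comp_swapBlock r c hc⟩

theorem parityFn_comp_swapBlock [Fintype ι] (h1 : ∀ i, s i ≠ i) {a : ι × Bool → Bool} {r : ι}
    (hr : Escapes s r a) : parityFn s false a = parityFn s true (a ∘ swapBlock r) := by
  have hinv : (a ∘ swapBlock r) ∘ swapBlock r = a := by
    funext q
    simp [swapBlock_swapBlock]
  have hr' : Escapes s r (a ∘ swapBlock r) := by
    intro h2 h3
    obtain ⟨c, hc1, hc2, hc⟩ := hr (by simpa [swapBlock_of_ne (h1 r)] using h2)
      (by simpa [swapBlock_of_ne (h1 r)] using h3)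
    exact ⟨c, hc1, hc2, exists_comp_swapBlock r c hc⟩
  unfold parityFn
  rw [decide_eq_decide]
  constructor
  · exact Or.imp (CycleTrue.comp_swapBlock hr) (IsParityTransversal.comp_swapBlock r)
  · rintro (h | h)
    · exact Or.inl (hinv ▸ h.comp_swapBlock hr')
    · exact Or.inr (hinv ▸ h.comp_swapBlock r)

/-- A block with equal entries rules out transversals, the only place where the two functions
differ. -/
theorem parityFn_eq_of_eq [Fintype ι] {a : ι × Bool → Bool} {p : ι}
    (h : a (p, false) = a (p, true)) : parityFn s false a = parityFn s true a := by
  have : ∀ ε, ¬ IsParityTransversal ε a := by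
    intro ε hε
    have := hε.1 p
    rw [h] at this
    simp at this
  simp [parityFn, this]

/-- A point strictly above a transversal has a full block `j` and meets all blocks. The blocks
before and after `j` are distinct because `s` has no 2-cycle, so `CycleTrue` holds. -/
theorem monotone_parityFn [Fintype ι] (h1 : ∀ i, s i ≠ i) (h2 : ∀ i, s (s i) ≠ i) (ε : Bool) :
    Monotone (parityFn s ε) := by
  intro a b hab ha
  have hab' : ∀ q, a q = true → b q = true := fun q => hab q
  simp only [parityFn, decide_eq_true_eq] at ha ⊢
  rcases ha with ⟨i, h3, h4, h5⟩ | ha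
  · refine Or.inl ⟨i, hab' _ h3, hab' _ h4, h5.imp (hab' _) ?_⟩
    rintro ⟨h6, c, hc1, hc2, β, hβ⟩
    exact ⟨hab' _ h6, c, hc1, hc2, β, hab' _ hβ⟩
  · have hblock : ∀ i, ∃ β, a (i, β) = true := by
      intro i
      have := ha.1 i
      cases h : a (i, false)
      · exact ⟨true, by simpa [h] using this⟩
      · exact ⟨false, h⟩
    by_cases he : a = b
    · exact Or.inr (he ▸ ha)
    · obtain ⟨⟨j, β⟩, hq⟩ := Function.ne_iff.1 he
      have hb : b (j, β) = true ∧ a (j, β) = false := by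
        have := hab' (j, β)
        revert this hq
        cases a (j, β) <;> cases b (j, β) <;> simp
      have hb' : ∀ γ, b (j, γ) = true := by
        have := ha.1 j
        have h3 := hab' (j, !β)
        intro γ
        rcases eq_or_ne γ β with rfl | hγ
        · exact hb.1
        · have hγ' : γ = !β := Bool.eq_not.2 hγ
          rw [hγ']
          apply h3
          have h4 := hb.2
          cases β <;> simp_all
      refine Or.inl ⟨s.symm j, by simp [hb'], by simp [hb'], ?_⟩
      obtain ⟨β, hβ⟩ := hblock (s.symm j)
      cases β
      · exact Or.inl (hab' _ hβ)
      · refine Or.inr ⟨hab' _ hβ, s j, fun h => h2 (s.symm j) ?_, ?_, ?_⟩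
        · simpa using h
        · simpa using h1 j
        · obtain ⟨β, hβ⟩ := hblock (s j)
          exact ⟨β, hab' _ hβ⟩

/-! ### Small and large true points -/

variable (s) in
/-- The minimal true point formed by the block of `s i` and the first element of the block
of `i`. -/
noncomputable def smallPoint (i : ι) : ι × Bool → Bool :=
  fun q => decide (q = (i, false) ∨ q = (s i, false) ∨ q = (s i, true))

theorem cycleTrue_smallPoint (i : ι) : CycleTrue s (smallPoint s i) :=
  ⟨i, by simp [smallPoint], by simp [smallPoint], Or.inl (by simp [smallPoint])⟩

theorem parityFn_smallPoint [Fintype ι] (ε : Bool) (i : ι) :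
    parityFn s ε (smallPoint s i) = true :=
  decide_eq_true (Or.inl (cycleTrue_smallPoint i))

theorem card_smallPoint_le [Fintype ι] (i : ι) :
    (Finset.univ.filter fun q => smallPoint s i q = true).card ≤ 3 := by
  have : (Finset.univ.filter fun q => smallPoint s i q = true) =
      {(i, false), (s i, false), (s i, true)} := by
    ext q
    simp [smallPoint]
  rw [this]
  exact Finset.card_le_three

theorem eq_smallPoint [Fintype ι] (h1 : ∀ i, s i ≠ i) (hι : 7 ≤ Fintype.card ι) {ε : Bool}
    {a : ι × Bool → Bool} (h : parityFn s ε a = true)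
    (hc : (Finset.univ.filter fun q => a q = true).card ≤ 3) : ∃ i, a = smallPoint s i := by
  simp only [parityFn, decide_eq_true_eq] at h
  rcases h with ⟨i, h2, h3, h4 | ⟨h4, c, hc1, hc2, β, hβ⟩⟩ | h
  · have hsub : ({(i, false), (s i, false), (s i, true)} : Finset (ι × Bool)) ⊆
        Finset.univ.filter fun q => a q = true := by
      intro q
      simp only [Finset.mem_insert, Finset.mem_singleton, Finset.mem_filter, Finset.mem_univ,
        true_and]
      rintro (rfl | rfl | rfl) <;> assumption
    have hcard : ({(i, false), (s i, false), (s i, true)} : Finset (ι × Bool)).card = 3 :=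
      Finset.card_eq_three.2 ⟨_, _, _, by simp [(h1 i).symm], by simp, by simp, rfl⟩
    have heq := Finset.eq_of_subset_of_card_le hsub (by rw [hcard]; exact hc)
    refine ⟨i, funext fun q => ?_⟩
    have := Finset.ext_iff.1 heq q
    simp only [Finset.mem_insert, Finset.mem_singleton, Finset.mem_filter, Finset.mem_univ,
      true_and] at this
    rw [Bool.eq_iff_iff, ← this]
    simp [smallPoint]
  · exfalso
    have hsub : insert (c, β) ({(i, true), (s i, false), (s i, true)} : Finset (ι × Bool)) ⊆
        Finset.univ.filter fun q => a q = true := by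
      intro q
      simp only [Finset.mem_insert, Finset.mem_singleton, Finset.mem_filter, Finset.mem_univ,
        true_and]
      rintro (rfl | rfl | rfl | rfl) <;> assumption
    have hcard : ({(i, true), (s i, false), (s i, true)} : Finset (ι × Bool)).card = 3 :=
      Finset.card_eq_three.2 ⟨_, _, _, by simp, by simp [(h1 i).symm], by simp, rfl⟩
    have := Finset.card_le_card hsub
    rw [Finset.card_insert_of_notMem (by simp [hc1, hc2]), hcard] at this
    omega
  · exfalso
    have hsub : (Finset.univ.image fun i : ι => (i, a (i, true))) ⊆
        Finset.univ.filter fun q => a q = true := by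
      intro q hq
      obtain ⟨i, -, rfl⟩ := Finset.mem_image.1 hq
      have := h.1 i
      cases h0 : a (i, false) <;> simp_all
    have := Finset.card_le_card hsub
    rw [Finset.card_image_of_injective _ fun i j hij => congrArg Prod.fst hij,
      Finset.card_univ] at this
    omega

theorem parityFn_eq_true_of_card_le [Fintype ι] (hι : 7 ≤ Fintype.card ι) (ε : Bool)
    {a : ι × Bool → Bool} (hc : (Finset.univ.filter fun q => a q = false).card ≤ 3) :
    parityFn s ε a = true := by
  refine decide_eq_true (Or.inl ?_)
  by_contra hcon
  set M := Finset.univ.filter fun q => a q = false with hM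
  -- Each index is blocked by a missing point of its own block or of the next one, so three missing
  -- points block at most six indices. Hence the bound 7.
  have hsub : (Finset.univ : Finset ι) ⊆ M.image Prod.fst ∪ M.image fun q => s.symm q.1 := by
    intro i _
    simp only [CycleTrue, not_exists, not_and, not_or] at hcon
    rw [Finset.mem_union, Finset.mem_image, Finset.mem_image]
    by_cases h2 : a (s i, false) = true
    · by_cases h3 : a (s i, true) = true
      · exact Or.inl ⟨(i, false), by simpa [hM] using (hcon i h2 h3).1, rfl⟩
      · exact Or.inr ⟨(s i, true), by simpa [hM] using h3, by simp⟩
    · exact Or.inr ⟨(s i, false), by simpa [hM] using h2, by simp⟩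
  have h2 := Finset.card_le_card hsub
  have h3 := Finset.card_union_le (M.image Prod.fst) (M.image fun q => s.symm q.1)
  have h4 := Finset.card_image_le (s := M) (f := Prod.fst)
  have h5 := Finset.card_image_le (s := M) (f := fun q => s.symm q.1)
  rw [Finset.card_univ] at h2
  omega

theorem parityFn_eq_false_of_card_le [Fintype ι] (h1 : ∀ i, s i ≠ i) (hι : 7 ≤ Fintype.card ι)
    (ε : Bool) {a : ι × Bool → Bool} {u v : ι × Bool} (ha : ∀ q, a q = true → q = u ∨ q = v) :
    parityFn s ε a = false := by
  rw [← Bool.not_eq_true]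
  intro h
  have hsub : (Finset.univ.filter fun q => a q = true) ⊆ {u, v} := fun q hq => by
    simpa using ha q (Finset.mem_filter.1 hq).2
  obtain ⟨i, rfl⟩ := eq_smallPoint h1 hι h
    ((Finset.card_le_card hsub).trans (Finset.card_le_two.trans (by norm_num)))
  have e1 := ha (i, false) (by simp [smallPoint])
  have e2 := ha (s i, false) (by simp [smallPoint])
  have e3 := ha (s i, true) (by simp [smallPoint])
  have := h1 i
  rcases e1 with rfl | rfl <;> rcases e2 with e2 | e2 <;> simp_all
  · exact absurd (e3.trans e2.symm) (by simp)
  · exact absurd (e3.trans e2.symm) (by simp)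

theorem exists_parityFn_ne [Fintype ι] (h1 : ∀ i, s i ≠ i) (hι : 7 ≤ Fintype.card ι) (ε : Bool)
    (q : ι × Bool) : ∃ a b : ι × Bool → Bool, (∀ q', q' ≠ q → a q' = b q') ∧
      parityFn s ε a = true ∧ parityFn s ε b = false := by
  obtain ⟨k, β⟩ := q
  set i := s.symm k with hi
  have hk : s i = k := by simp [hi]
  refine ⟨smallPoint s i, fun q => smallPoint s i q && !decide (q = (k, β)), ?_,
    parityFn_smallPoint ε i, ?_⟩
  · intro q hq
    simp [hq]
  · refine parityFn_eq_false_of_card_le h1 hι ε (u := (i, false)) (v := (k, !β)) fun q hq => ?_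
    simp only [smallPoint, hk, Bool.and_eq_true, decide_eq_true_eq, Bool.not_eq_true',
      decide_eq_false_iff_not] at hq
    obtain ⟨rfl | rfl | rfl, h2⟩ := hq
    · exact Or.inl rfl
    · cases β <;> simp_all
    · cases β <;> simp_all

/-! ### The two functions are not equivalent -/

theorem card_comp_perm {Q : Type} [Fintype Q] (a : Q → Bool) (σ : Equiv.Perm Q) (c : Bool) :
    (Finset.univ.filter fun q => (a ∘ σ) q = c).card =
      (Finset.univ.filter fun q => a q = c).card := by
  refine Finset.card_bij (fun q _ => σ q) ?_ (fun p _ q _ h => σ.injective h) ?_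
  · intro q hq
    simpa using hq
  · intro q hq
    exact ⟨σ.symm q, by simpa using hq, by simp⟩

/-- A second element lies in only one small point, whereas a first element (l, 0) lies in two, those
of `l` and of its predecessor. -/
theorem snd_eq_false_of_smallPoint_comp (h1 : ∀ i, s i ≠ i) {σ : Equiv.Perm (ι × Bool)}
    (h : ∀ i, ∃ j, smallPoint s i ∘ σ = smallPoint s j) {q : ι × Bool}
    (hq : (σ q).2 = false) : q.2 = false := by
  obtain ⟨k, β⟩ := q
  cases β
  · rfl
  obtain ⟨l, hl⟩ : ∃ l, σ (k, true) = (l, false) := ⟨_, Prod.ext rfl hq⟩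
  exfalso
  have key : ∀ i, smallPoint s i (l, false) = true →
      smallPoint s i ∘ σ = smallPoint s (s.symm k) := by
    intro i hi
    obtain ⟨j, hj⟩ := h i
    have : smallPoint s j (k, true) = true := by rw [← hj, Function.comp_apply, hl, hi]
    have hjk : k = s j := by simpa [smallPoint] using this
    rw [hj, hjk]
    simp
  have e := (key l (by simp [smallPoint])).trans
    (key (s.symm l) (by simp [smallPoint])).symm
  have e' : smallPoint s l = smallPoint s (s.symm l) := by
    funext q
    simpa using congrFun e (σ.symm q)
  have := congrFun e' (s l, true)
  simp [smallPoint, h1 l] at this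

/-- Such a permutation permutes the small points and so preserves second coordinates. The
transversal `T` with a single second element is true for ε = 1; its image also has a single second
element, hence is no even transversal. Nor does it satisfy `CycleTrue`, which would need a full
block inside `T` or two second elements. -/
theorem not_forall_parityFn_comp [Fintype ι] (h1 : ∀ i, s i ≠ i) (hι : 7 ≤ Fintype.card ι)
    (σ : Equiv.Perm (ι × Bool)) :
    ¬ ∀ a, parityFn s false a = parityFn s true (a ∘ σ) := by
  intro h
  have h2 : ∀ i, ∃ j, smallPoint s i ∘ σ = smallPoint s j := fun i =>
    eq_smallPoint h1 hι (ε := true) (by rw [← h, parityFn_smallPoint])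
      (by rw [card_comp_perm]; exact card_smallPoint_le i)
  have h3 : ∀ i, ∃ j, smallPoint s i ∘ σ.symm = smallPoint s j := fun i =>
    eq_smallPoint h1 hι (ε := false)
      (by rw [h, Function.comp_assoc]; simpa using parityFn_smallPoint true i)
      (by rw [card_comp_perm]; exact card_smallPoint_le i)
  have hsnd : ∀ q, (σ.symm q).2 = q.2 := by
    intro q
    have e1 := snd_eq_false_of_smallPoint_comp h1 h3 (q := q)
    have e2 := snd_eq_false_of_smallPoint_comp h1 h2 (q := σ.symm q)
    rw [Equiv.apply_symm_apply] at e2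
    cases h4 : (σ.symm q).2 <;> cases h5 : q.2 <;> simp_all
  obtain ⟨i₀⟩ : Nonempty ι := Fintype.card_pos_iff.1 (by omega)
  let T : ι × Bool → Bool := fun q => if q.2 then decide (q.1 = i₀) else !decide (q.1 = i₀)
  have hTt : ∀ i, T (i, true) = true ↔ i = i₀ := fun i => by simp [T]
  have hTf : ∀ i, T (i, false) = true ↔ i ≠ i₀ := fun i => by simp [T]
  have hT : parityFn s true T = true := by
    refine decide_eq_true (Or.inr ⟨fun i => by simp [T], ?_⟩)
    have : (Finset.univ.filter fun i => T (i, true) = true) = {i₀} := by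
      ext i
      simp [hTt]
    simp [this]
  have ha : parityFn s false (T ∘ σ.symm) = true := by
    rw [h, Function.comp_assoc]
    simpa using hT
  have hone : ∀ i, T (σ.symm (i, true)) = true ↔ i = (σ (i₀, true)).1 := by
    intro i
    have h4 : σ.symm (i, true) = ((σ.symm (i, true)).1, true) := Prod.ext rfl (hsnd _)
    have h5 : (σ (i₀, true)).2 = true := by
      rw [← hsnd, Equiv.symm_apply_apply]
    rw [h4, hTt]
    constructor
    · intro h6
      rw [h6, Equiv.symm_apply_eq] at h4
      rw [← h4]
    · intro h6
      have : (i, true) = σ (i₀, true) := Prod.ext h6 h5.symm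
      rw [this, Equiv.symm_apply_apply]
  simp only [parityFn, decide_eq_true_eq] at ha
  rcases ha with ⟨i, h4, h5, h6 | ⟨h6, -⟩⟩ | ⟨-, h4⟩
  · obtain ⟨j, hj⟩ := h2 i
    have hle : ∀ q, smallPoint s j q = true → T q = true := by
      intro q hq
      rw [← hj] at hq
      simp only [smallPoint, Function.comp_apply, decide_eq_true_eq] at hq
      have hq' : ∀ p, σ q = p → T q = (T ∘ σ.symm) p := by
        rintro p rfl
        simp
      rcases hq with hq | hq | hq
      · rw [hq' _ hq, h6]
      · rw [hq' _ hq, h4]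
      · rw [hq' _ hq, h5]
    exact (hTf _).1 (hle (s j, false) (by simp [smallPoint]))
      ((hTt _).1 (hle (s j, true) (by simp [smallPoint])))
  · exact h1 i (((hone _).1 h5).trans ((hone _).1 h6).symm)
  · have : (Finset.univ.filter fun i => (T ∘ σ.symm) (i, true) = true) =
        {(σ (i₀, true)).1} := by
      ext i
      simp [hone]
    rw [this] at h4
    simp at h4

/-! ### Pairs of strongly hypomorphic functions -/

/-- The extension of `swapBlock` to a larger index set. -/
noncomputable def swapBlockSum (Y : Type) (r : ι) : Equiv.Perm (Y ⊕ ι × Bool) :=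
  Equiv.sumCongr (Equiv.refl Y) (swapBlock r)

variable (s) in
/-- The function `x ∧ h_ε`. -/
noncomputable def andParityFn [Fintype ι] (ε : Bool) (a : Unit ⊕ ι × Bool → Bool) : Bool :=
  a (.inl ()) && parityFn s ε (a ∘ .inr)

variable (s) in
/-- The self-dual function that agrees with `h_ε` if `x = 1`, `y = 0`, and with `x` if `x = y`;
the arguments `x` and `y` are indexed by `1` and `0`. -/
noncomputable def selfDualParityFn [Fintype ι] (ε : Bool) (a : Bool ⊕ ι × Bool → Bool) : Bool :=
  if a (.inl true) = a (.inl false) then a (.inl true)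
  else if a (.inl true) = true then parityFn s ε (a ∘ .inr)
  else !parityFn s ε fun q => !a (.inr q)

theorem selfDualParityFn_of_true [Fintype ι] {ε : Bool} {a : Bool ⊕ ι × Bool → Bool}
    (h1 : a (.inl true) = true) (h0 : a (.inl false) = false) :
    selfDualParityFn s ε a = parityFn s ε (a ∘ .inr) := by
  simp [selfDualParityFn, h1, h0]

theorem selfDualParityFn_of_false [Fintype ι] {ε : Bool} {a : Bool ⊕ ι × Bool → Bool}
    (h1 : a (.inl true) = false) (h0 : a (.inl false) = true) :
    selfDualParityFn s ε a = !parityFn s ε fun q => !a (.inr q) := by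
  simp [selfDualParityFn, h1, h0]

theorem FixingHypomorphic.of_rel {P : Type} {F G : (P → Bool) → Bool} {R : P → P → Prop}
    (hR : ∀ u v, u ≠ v → R u v ∨ R v u)
    (h : ∀ u v, R u v → ∃ ρ : Equiv.Perm P, ρ u = u ∧ ρ v = v ∧
      ∀ a : P → Bool, a u = a v → F a = G (a ∘ ρ)) : FixingHypomorphic F G := by
  intro u v huv
  rcases hR u v huv with hR | hR
  · exact h u v hR
  · obtain ⟨ρ, h1, h2, h3⟩ := h v u hR
    exact ⟨ρ, h2, h1, fun a ha => h3 a ha.symm⟩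

variable (s) in
/-- `p` is the block following `r`, and `q` is a third block. -/
def Separates (r p q : ι) : Prop := s r = p ∧ q ≠ r ∧ q ≠ s r

/-- The predecessor of `p` works unless it is `q`; then the predecessor of `q` works, as there are
no 2-cycles. -/
theorem exists_separates (h2 : ∀ i, s (s i) ≠ i) {p q : ι} (h : p ≠ q) :
    ∃ r, Separates s r p q ∨ Separates s r q p := by
  by_cases hq : q = s.symm p
  · refine ⟨s.symm q, Or.inr ⟨by simp, fun hp => h2 (s.symm q) ?_, by simpa using h⟩⟩
    rw [Equiv.apply_symm_apply, ← hp, hq]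
    simp
  · exact ⟨s.symm p, Or.inl ⟨by simp, hq, by simpa using h.symm⟩⟩

/-- If the block of `p` is full, the common value is 1, so the block of `q` provides the required
element. -/
theorem Separates.escapes {r p q : ι} (h : Separates s r p q) {a : ι × Bool → Bool} {β γ : Bool}
    (ha : a (p, β) = a (q, γ)) : Escapes s r a := by
  intro h3 h4
  refine ⟨q, h.2.1, h.2.2, γ, ?_⟩
  rw [← ha, ← h.1]
  cases β <;> assumption

theorem Separates.swapBlockSum_inr (h1 : ∀ i, s i ≠ i) {Y : Type} {r p q : ι}
    (h : Separates s r p q) (β γ : Bool) :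
    swapBlockSum Y r (.inr (p, β)) = .inr (p, β) ∧
      swapBlockSum Y r (.inr (q, γ)) = .inr (q, γ) := by
  simp [swapBlockSum, swapBlock_of_ne h.2.1, swapBlock_of_ne (h.1 ▸ h1 r)]

theorem andParityFn_swap [Fintype ι] (h1 : ∀ i, s i ≠ i) {a : Unit ⊕ ι × Bool → Bool} {r : ι}
    (h : a (.inl ()) = true → Escapes s r (a ∘ .inr)) :
    andParityFn s false a = andParityFn s true (a ∘ swapBlockSum Unit r) := by
  unfold andParityFn
  cases ha : a (.inl ())
  · simp [swapBlockSum, ha]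
  · rw [parityFn_comp_swapBlock h1 (h ha)]
    simp only [swapBlockSum, Function.comp_apply, Equiv.sumCongr_apply, Sum.map_inl,
      Equiv.refl_apply, ha]
    rfl

theorem selfDualParityFn_swap [Fintype ι] (h1 : ∀ i, s i ≠ i) {a : Bool ⊕ ι × Bool → Bool} {r : ι}
    (h : a (.inl true) = true → a (.inl false) = false → Escapes s r (a ∘ .inr))
    (h' : a (.inl true) = false → a (.inl false) = true → Escapes s r fun q => !a (.inr q)) :
    selfDualParityFn s false a = selfDualParityFn s true (a ∘ swapBlockSum Bool r) := by
  have e : ∀ b, (a ∘ swapBlockSum Bool r) (.inl b) = a (.inl b) := fun b => rfl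
  cases hx : a (.inl true) <;> cases hy : a (.inl false)
  · rw [selfDualParityFn, selfDualParityFn, e, e]
    simp [hx, hy]
  · rw [selfDualParityFn_of_false hx hy, selfDualParityFn_of_false (by rw [e, hx]) (by rw [e, hy]),
      parityFn_comp_swapBlock h1 (h' hx hy)]
    rfl
  · rw [selfDualParityFn_of_true hx hy, selfDualParityFn_of_true (by rw [e, hx]) (by rw [e, hy]),
      parityFn_comp_swapBlock h1 (h hx hy)]
    rfl
  · rw [selfDualParityFn, selfDualParityFn, e, e]
    simp [hx, hy]

theorem fixingHypomorphic_andParityFn [Fintype ι] (h1 : ∀ i, s i ≠ i) (h2 : ∀ i, s (s i) ≠ i) :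
    FixingHypomorphic (andParityFn s false) (andParityFn s true) := by
  refine FixingHypomorphic.of_rel (R := fun u v =>
    (∃ p, u = .inr (p, false) ∧ v = .inr (p, true)) ∨
    (∃ r p β q γ, Separates s r p q ∧ u = .inr (p, β) ∧ v = .inr (q, γ)) ∨
    (∃ q γ, u = .inl () ∧ v = .inr (q, γ))) ?_ ?_
  · rintro (⟨⟩ | ⟨p, β⟩) (⟨⟩ | ⟨q, γ⟩) huv
    · exact absurd rfl huv
    · exact Or.inl (Or.inr (Or.inr ⟨q, γ, rfl, rfl⟩))
    · exact Or.inr (Or.inr (Or.inr ⟨p, β, rfl, rfl⟩))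
    · rcases eq_or_ne p q with rfl | hpq
      · cases β <;> cases γ
        · exact absurd rfl huv
        · exact Or.inl (Or.inl ⟨p, rfl, rfl⟩)
        · exact Or.inr (Or.inl ⟨p, rfl, rfl⟩)
        · exact absurd rfl huv
      · obtain ⟨r, hr | hr⟩ := exists_separates h2 hpq
        · exact Or.inl (Or.inr (Or.inl ⟨r, p, β, q, γ, hr, rfl, rfl⟩))
        · exact Or.inr (Or.inr (Or.inl ⟨r, q, γ, p, β, hr, rfl, rfl⟩))
  · rintro u v (⟨p, rfl, rfl⟩ | ⟨r, p, β, q, γ, hr, rfl, rfl⟩ | ⟨q, γ, rfl, rfl⟩)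
    · refine ⟨1, rfl, rfl, fun a ha => ?_⟩
      have e := parityFn_eq_of_eq (s := s) (a := a ∘ .inr) ha
      change andParityFn s false a = andParityFn s true a
      unfold andParityFn
      rw [e]
    · obtain ⟨e1, e2⟩ := hr.swapBlockSum_inr h1 (Y := Unit) β γ
      exact ⟨swapBlockSum Unit r, e1, e2, fun a ha => andParityFn_swap h1 fun _ =>
        hr.escapes (a := a ∘ .inr) ha⟩
    -- If x = 1, the argument identified with x is true. Its block `q` is distinct from `s q` and `s
    -- (s q)`, so it supplies the third block; if x = 0, both functions vanish.
    · refine ⟨swapBlockSum Unit (s q), rfl, ?_, fun a ha => andParityFn_swap h1 fun hx _ _ =>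
        ⟨q, (h1 q).symm, (h2 q).symm, γ, ha.symm.trans hx⟩⟩
      simp [swapBlockSum, swapBlock_of_ne (h1 q).symm]

theorem fixingHypomorphic_selfDualParityFn [Fintype ι] (h1 : ∀ i, s i ≠ i) (h2 : ∀ i, s (s i) ≠ i) :
    FixingHypomorphic (selfDualParityFn s false) (selfDualParityFn s true) := by
  refine FixingHypomorphic.of_rel (R := fun u v =>
    (∃ p, u = .inr (p, false) ∧ v = .inr (p, true)) ∨
    (∃ r p β q γ, Separates s r p q ∧ u = .inr (p, β) ∧ v = .inr (q, γ)) ∨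
    (∃ q γ, u = .inl true ∧ v = .inr (q, γ)) ∨
    (∃ q γ, u = .inl false ∧ v = .inr (q, γ)) ∨ (u = .inl true ∧ v = .inl false)) ?_ ?_
  · rintro (b | ⟨p, β⟩) (c | ⟨q, γ⟩) huv
    · cases b <;> cases c
      · exact absurd rfl huv
      · exact Or.inr (Or.inr (Or.inr (Or.inr (Or.inr ⟨rfl, rfl⟩))))
      · exact Or.inl (Or.inr (Or.inr (Or.inr (Or.inr ⟨rfl, rfl⟩))))
      · exact absurd rfl huv
    · cases b
      · exact Or.inl (Or.inr (Or.inr (Or.inr (Or.inl ⟨q, γ, rfl, rfl⟩))))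
      · exact Or.inl (Or.inr (Or.inr (Or.inl ⟨q, γ, rfl, rfl⟩)))
    · cases c
      · exact Or.inr (Or.inr (Or.inr (Or.inr (Or.inl ⟨p, β, rfl, rfl⟩))))
      · exact Or.inr (Or.inr (Or.inr (Or.inl ⟨p, β, rfl, rfl⟩)))
    · rcases eq_or_ne p q with rfl | hpq
      · cases β <;> cases γ
        · exact absurd rfl huv
        · exact Or.inl (Or.inl ⟨p, rfl, rfl⟩)
        · exact Or.inr (Or.inl ⟨p, rfl, rfl⟩)
        · exact absurd rfl huv
      · obtain ⟨r, hr | hr⟩ := exists_separates h2 hpq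
        · exact Or.inl (Or.inr (Or.inl ⟨r, p, β, q, γ, hr, rfl, rfl⟩))
        · exact Or.inr (Or.inr (Or.inl ⟨r, q, γ, p, β, hr, rfl, rfl⟩))
  · rintro u v (⟨p, rfl, rfl⟩ | ⟨r, p, β, q, γ, hr, rfl, rfl⟩ | ⟨q, γ, rfl, rfl⟩ |
      ⟨q, γ, rfl, rfl⟩ | ⟨rfl, rfl⟩)
    · refine ⟨1, rfl, rfl, fun a ha => ?_⟩
      have e1 := parityFn_eq_of_eq (s := s) (a := a ∘ .inr) ha
      have e2 := parityFn_eq_of_eq (s := s) (a := fun q => !a (.inr q)) (congrArg not ha)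
      change selfDualParityFn s false a = selfDualParityFn s true a
      unfold selfDualParityFn
      rw [e1, e2]
    · obtain ⟨e1, e2⟩ := hr.swapBlockSum_inr h1 (Y := Bool) β γ
      exact ⟨swapBlockSum Bool r, e1, e2, fun a ha => selfDualParityFn_swap h1
        (fun _ _ => hr.escapes (a := a ∘ .inr) ha)
        (fun _ _ => hr.escapes (a := fun q => !a (.inr q)) (congrArg not ha))⟩
    · refine ⟨swapBlockSum Bool (s q), rfl, ?_, fun a ha => selfDualParityFn_swap h1
        (fun hx _ _ _ => ⟨q, (h1 q).symm, (h2 q).symm, γ, ha.symm.trans hx⟩)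
        (fun hx _ _ _ => ⟨q, (h1 q).symm, (h2 q).symm, γ, ?_⟩)⟩
      · simp [swapBlockSum, swapBlock_of_ne (h1 q).symm]
      · change (!a (.inr (q, γ))) = true
        rw [← ha, hx]
        rfl
    -- Here y is identified with an element of block `q`. In the relevant cases this element is 0
    -- (after complementation in the second), so block `q` is not full and `Escapes` for its
    -- predecessor is vacuous.
    · have hq : s (s.symm q) = q := by simp
      have hne : q ≠ s.symm q := by
        conv_lhs => rw [← hq]
        exact h1 _
      refine ⟨swapBlockSum Bool (s.symm q), rfl, ?_, fun a ha => selfDualParityFn_swap h1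
        (fun _ hy h3 h4 => ?_) (fun _ hy h3 h4 => ?_)⟩
      · simp [swapBlockSum, swapBlock_of_ne hne]
      · rw [hq] at h3 h4
        rw [ha] at hy
        cases γ
        · exact absurd (hy.symm.trans h3) (by simp)
        · exact absurd (hy.symm.trans h4) (by simp)
      · rw [hq] at h3 h4
        rw [ha] at hy
        cases γ
        · simp [hy] at h3
        · simp [hy] at h4
    · refine ⟨1, rfl, rfl, fun a ha => ?_⟩
      change selfDualParityFn s false a = selfDualParityFn s true a
      simp [selfDualParityFn, ha]

theorem exists_perm_of_inl {Y Q : Type} [Finite Y] [Finite Q] (σ : Equiv.Perm (Y ⊕ Q))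
    (h : ∀ y, ∃ y', σ (.inl y) = .inl y') :
    ∃ (τ : Equiv.Perm Y) (ρ : Equiv.Perm Q), σ = Equiv.sumCongr τ ρ := by
  have : σ ∈ (Equiv.Perm.sumCongrHom Y Q).range := by
    refine Equiv.Perm.mem_sumCongrHom_range_of_perm_mapsTo_inl ?_
    rintro _ ⟨y, rfl⟩
    obtain ⟨y', hy⟩ := h y
    exact ⟨y', hy.symm⟩
  obtain ⟨⟨τ, ρ⟩, h⟩ := this
  exact ⟨τ, ρ, h.symm⟩

theorem not_exists_andParityFn_comp [Fintype ι] (h1 : ∀ i, s i ≠ i) (h2 : ∀ i, s (s i) ≠ i)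
    (hι : 7 ≤ Fintype.card ι) :
    ¬ ∃ σ, ∀ a, andParityFn s false a = andParityFn s true (a ∘ σ) := by
  rintro ⟨σ, hσ⟩
  have hbij : Function.Bijective σ := by
    refine bijective_of_essential hσ ?_
    rintro (⟨⟩ | q)
    · obtain ⟨i⟩ : Nonempty ι := Fintype.card_pos_iff.1 (by omega)
      refine ⟨Sum.elim (fun _ => true) (smallPoint s i),
        Sum.elim (fun _ => false) (smallPoint s i), ?_, ?_⟩
      · rintro (⟨⟩ | q) hq
        · exact absurd rfl hq
        · rfl
      · simp [andParityFn, parityFn_smallPoint]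
    · obtain ⟨a, b, hab, ha, hb⟩ := exists_parityFn_ne h1 hι false q
      refine ⟨Sum.elim (fun _ => true) a, Sum.elim (fun _ => true) b, ?_, ?_⟩
      · rintro (⟨⟩ | q') hq
        · rfl
        · exact hab q' fun h => hq (h ▸ rfl)
      · simp [andParityFn, ha, hb]
  obtain ⟨σ, rfl⟩ : ∃ σ' : Equiv.Perm _, σ = σ' := ⟨Equiv.ofBijective σ hbij, rfl⟩
  obtain ⟨τ, ρ, rfl⟩ := exists_perm_of_inl σ <| by
    rintro ⟨⟩
    rcases hx : σ (.inl ()) with y | ⟨k, β⟩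
    · exact ⟨y, rfl⟩
    · exfalso
      -- This small point lives in the two blocks after `k`, so it is a true point missing block
      -- `k`.
      have := hσ (Sum.elim (fun _ => true) (smallPoint s (s k)))
      simp [andParityFn, parityFn_smallPoint, hx, smallPoint, (h1 k).symm, (h2 k).symm] at this
  refine not_forall_parityFn_comp h1 hι ρ fun a => ?_
  have := hσ (Sum.elim (fun _ => true) a)
  simpa [andParityFn, Function.comp_def] using this

/-- The pair {x, y} meets every true point, and no other pair of arguments does, so the permutation
preserves it. Exchanging x and y is excluded by the small points; fixing them reduces to h_0 and
h_1. -/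
theorem not_exists_selfDualParityFn_comp [Fintype ι] (h1 : ∀ i, s i ≠ i) (hι : 7 ≤ Fintype.card ι) :
    ¬ ∃ σ, ∀ a, selfDualParityFn s false a = selfDualParityFn s true (a ∘ σ) := by
  rintro ⟨σ, hσ⟩
  have hempty : parityFn s false (fun _ => false) = false := by
    obtain ⟨i⟩ : Nonempty ι := Fintype.card_pos_iff.1 (by omega)
    exact parityFn_eq_false_of_card_le h1 hι _ (u := (i, false)) (v := (i, false)) (by simp)
  have hfull : parityFn s false (fun _ => true) = true :=
    parityFn_eq_true_of_card_le hι _ (by simp)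
  have hbij : Function.Bijective σ := by
    refine bijective_of_essential hσ ?_
    rintro ((_ | _) | q)
    · refine ⟨Sum.elim (fun _ => true) fun _ => false, Sum.elim (fun b => b) fun _ => false, ?_, ?_⟩
      · rintro ((_ | _) | q) hq <;> simp_all
      · simp [selfDualParityFn, Function.comp_def, hempty]
    · refine ⟨Sum.elim (fun _ => true) fun _ => false, Sum.elim (fun b => !b) fun _ => false,
        ?_, ?_⟩
      · rintro ((_ | _) | q) hq <;> simp_all
      · simp [selfDualParityFn, hfull]
    · obtain ⟨a, b, hab, ha, hb⟩ := exists_parityFn_ne h1 hι false q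
      refine ⟨Sum.elim (fun b => b) a, Sum.elim (fun b => b) b, ?_, ?_⟩
      · rintro (_ | q') hq
        · rfl
        · exact hab q' fun h => hq (h ▸ rfl)
      · simp [selfDualParityFn, ha, hb]
  obtain ⟨σ, rfl⟩ : ∃ σ' : Equiv.Perm _, σ = σ' := ⟨Equiv.ofBijective σ hbij, rfl⟩
  have hhit : ∀ a, selfDualParityFn s false a = true →
      a (σ (.inl true)) = true ∨ a (σ (.inl false)) = true := by
    intro a ha
    rw [hσ] at ha
    by_contra hcon
    simp only [not_or, Bool.not_eq_true] at hcon
    simp [selfDualParityFn, hcon] at ha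
  have hno : ∀ (t : ι × Bool) (q : Bool ⊕ ι × Bool), ¬ ∀ a, selfDualParityFn s false a = true →
      a (.inr t) = true ∨ a q = true := by
    intro t q h
    rcases q with (_ | _) | v
    · have := h (Sum.elim (fun b => b) fun u => !decide (u = t)) (by
        rw [selfDualParityFn_of_true rfl rfl]
        refine parityFn_eq_true_of_card_le hι _ ?_
        have : (Finset.univ.filter fun q =>
            ((Sum.elim (fun b => b) fun u => !decide (u = t)) ∘ Sum.inr) q = false) = {t} := by
          ext q
          simp
        rw [this]
        simp)
      simp at this
    · have := h (Sum.elim (fun b => !b) fun u => !decide (u = t)) (by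
        rw [selfDualParityFn_of_false rfl rfl,
          parityFn_eq_false_of_card_le h1 hι _ (u := t) (v := t) (by simp)]
        rfl)
      simp at this
    · have := h (Sum.elim (fun b => !b) fun u => !decide (u = t ∨ u = v)) (by
        rw [selfDualParityFn_of_false rfl rfl,
          parityFn_eq_false_of_card_le h1 hι _ (u := t) (v := v) (by simp)]
        rfl)
      simp at this
  obtain ⟨τ, ρ, rfl⟩ := exists_perm_of_inl σ <| by
    rintro (_ | _)
    · rcases hx : σ (.inl false) with y | t
      · exact ⟨y, rfl⟩
      · exact absurd (fun a ha => hx ▸ (hhit a ha).symm) (hno t (σ (.inl true)))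
    · rcases hx : σ (.inl true) with y | t
      · exact ⟨y, rfl⟩
      · exact absurd (fun a ha => hx ▸ hhit a ha) (hno t (σ (.inl false)))
  have hτ : τ false = !τ true := by
    have := τ.injective.ne (show (false : Bool) ≠ true by simp)
    revert this
    cases τ false <;> cases τ true <;> simp
  cases ht : τ true
  · obtain ⟨i⟩ : Nonempty ι := Fintype.card_pos_iff.1 (by omega)
    -- On the right h_1 is evaluated at a point with at most three zeros, hence is 1 and gets
    -- negated, while h_0 is 1 on the left.
    have := hσ (Sum.elim (fun b => b) (smallPoint s i))
    rw [selfDualParityFn_of_true rfl rfl, selfDualParityFn_of_false (by simp [ht])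
      (by simp [ht, hτ])] at this
    rw [parityFn_eq_true_of_card_le hι true] at this
    · have e := parityFn_smallPoint (s := s) false i
      exact absurd (e.symm.trans this) (by simp)
    · have := card_comp_perm (smallPoint s i) ρ true
      simpa using this.trans_le (card_smallPoint_le i)
  · refine not_forall_parityFn_comp h1 hι ρ fun a => ?_
    have := hσ (Sum.elim (fun b => b) a)
    rw [selfDualParityFn_of_true rfl rfl, selfDualParityFn_of_true (by simp [ht])
      (by simp [ht, hτ])] at this
    exact this

end Cyclic

/-! ### Nonreconstructible pairs in clones -/

section Pairs

variable {ι : Type} [Fintype ι] {s : Equiv.Perm ι} {C : FnClass Bool Bool} {n : ℕ}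

theorem parityFn_true (hι : 7 ≤ Fintype.card ι) (ε : Bool) :
    parityFn s ε (fun _ => true) = true :=
  parityFn_eq_true_of_card_le hι ε (by simp)

theorem ofIndex_andParityFn_mem (hC : IsClone C) (h : andOr ∈ C 3) (h1 : ∀ i, s i ≠ i)
    (h2 : ∀ i, s (s i) ≠ i) (hι : 7 ≤ Fintype.card ι) (e : Unit ⊕ ι × Bool ≃ Fin n) (ε : Bool) :
    ofIndex e (andParityFn s ε) ∈ C n := by
  have hx := hC.proj n (e (.inl ()))
  refine monotone_induction
    (R := fun F => ofIndex e (fun a => a (.inl ()) && F (a ∘ .inr)) ∈ C n) ?_ ?_ ?_ ?_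
    (monotone_parityFn h1 h2 ε) (parityFn_true hι ε)
  · intro q
    have hq := hC.proj n (e (.inr q))
    refine IsClone.mem_of_forall_eq (hC.comp₃ h hx hq hq) fun a => ?_
    simp [ofIndex, andOr]
  · refine IsClone.mem_of_forall_eq hx fun a => ?_
    simp [ofIndex]
  · intro F G hF hG
    refine IsClone.mem_of_forall_eq (hC.comp₃ h hF hG hG) fun a => ?_
    simp only [ofIndex, andOr, Function.comp_apply, Matrix.cons_val_zero, Matrix.cons_val_one,
      Matrix.cons_val]
    cases a (e (.inl ())) <;> simp
  · intro F G hF hG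
    refine IsClone.mem_of_forall_eq (hC.comp₃ h hx hF hG) fun a => ?_
    simp only [ofIndex, andOr, Function.comp_apply, Matrix.cons_val_zero, Matrix.cons_val_one,
      Matrix.cons_val]
    cases a (e (.inl ())) <;> simp

/-- Write Φ for the self-dual extension. Then Φ(F ∧ G) = maj(Φ F, Φ G, y) and Φ(F ∨ G) = maj(Φ F, Φ
G, x), a projection p gives maj(x, y, p), and the constant 1 gives x. -/
theorem ofIndex_selfDualParityFn_mem (hC : IsClone C) (h : majOp ∈ C 3) (h1 : ∀ i, s i ≠ i)
    (h2 : ∀ i, s (s i) ≠ i) (hι : 7 ≤ Fintype.card ι) (e : Bool ⊕ ι × Bool ≃ Fin n) (ε : Bool) :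
    ofIndex e (selfDualParityFn s ε) ∈ C n := by
  have hx := hC.proj n (e (.inl true))
  have hy := hC.proj n (e (.inl false))
  have hb : ∀ x y : Bool, (x && y || x || y) = (x || y) := by decide
  refine monotone_induction
    (R := fun F => ofIndex e (fun a => if a (.inl true) = a (.inl false) then a (.inl true)
      else if a (.inl true) = true then F (a ∘ .inr) else !F fun q => !a (.inr q)) ∈ C n)
    ?_ ?_ ?_ ?_ (monotone_parityFn h1 h2 ε) (parityFn_true hι ε)
  · intro q
    refine IsClone.mem_of_forall_eq (hC.comp₃ h hx hy (hC.proj n (e (.inr q)))) fun a => ?_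
    simp only [ofIndex, majOp, Function.comp_apply, Matrix.cons_val_zero, Matrix.cons_val_one,
      Matrix.cons_val]
    cases a (e (.inl true)) <;> cases a (e (.inl false)) <;> simp
  · refine IsClone.mem_of_forall_eq hx fun a => ?_
    simp only [ofIndex, Function.comp_apply]
    cases a (e (.inl true)) <;> cases a (e (.inl false)) <;> simp
  · intro F G hF hG
    refine IsClone.mem_of_forall_eq (hC.comp₃ h hF hG hy) fun a => ?_
    simp only [ofIndex, majOp, Function.comp_apply, Matrix.cons_val_zero, Matrix.cons_val_one,
      Matrix.cons_val]
    cases a (e (.inl true)) <;> cases a (e (.inl false)) <;> simp [hb]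
  · intro F G hF hG
    refine IsClone.mem_of_forall_eq (hC.comp₃ h hF hG hx) fun a => ?_
    simp only [ofIndex, majOp, Function.comp_apply, Matrix.cons_val_zero, Matrix.cons_val_one,
      Matrix.cons_val]
    cases a (e (.inl true)) <;> cases a (e (.inl false)) <;> simp [hb]

end Pairs

/-- `C` contains a pair of nonequivalent strongly hypomorphic functions of arity at least `N`. -/
def HasHypomorphicPair (C : FnClass Bool Bool) (N : ℕ) : Prop :=
  ∃ n : ℕ, N ≤ n ∧ ∃ f g : Fn Bool Bool n,
    f ∈ C n ∧ g ∈ C n ∧ ¬ Equivalent f g ∧ StronglyHypomorphic f g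

theorem HasHypomorphicPair.of_dualClass {C : FnClass Bool Bool} {N : ℕ}
    (h : HasHypomorphicPair (dualClass C) N) : HasHypomorphicPair C N := by
  obtain ⟨n, hn, f, g, hf, hg, hne, hfg⟩ := h
  exact ⟨n, hn, dual f, dual g, hf, hg, fun h => hne h.of_dual, hfg.dual⟩

/-- Rotation by 1 of a cycle of length `N + 8`, which is long enough for 1 and 2 to be nonzero. -/
theorem exists_cyclic_perm (N : ℕ) : ∃ (ι : Type) (_ : Fintype ι) (s : Equiv.Perm ι),
    (∀ i, s i ≠ i) ∧ (∀ i, s (s i) ≠ i) ∧ 7 ≤ Fintype.card ι ∧ N ≤ Fintype.card ι := by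
  have hcast : ∀ k : ℕ, 0 < k → k < N + 8 → (k : ZMod (N + 8)) ≠ 0 := fun k h0 hk h =>
    absurd (Nat.le_of_dvd h0 ((ZMod.natCast_eq_zero_iff k (N + 8)).1 h)) (by omega)
  refine ⟨ZMod (N + 8), inferInstance, Equiv.addRight 1, fun i h => ?_, fun i h => ?_, ?_, ?_⟩
  · exact hcast 1 (by omega) (by omega) (by simpa using h)
  · refine hcast 2 (by omega) (by omega) ?_
    change i + 1 + 1 = i at h
    rw [add_assoc, add_eq_left, one_add_one_eq_two] at h
    exact_mod_cast h
  · rw [ZMod.card]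
    omega
  · rw [ZMod.card]
    omega

theorem IsClone.hasHypomorphicPair_of_andOr {C : FnClass Bool Bool} (hC : IsClone C)
    (h : andOr ∈ C 3) (N : ℕ) : HasHypomorphicPair C N := by
  obtain ⟨ι, _, s, h1, h2, hι, hN⟩ := exists_cyclic_perm N
  refine ⟨Fintype.card (Unit ⊕ ι × Bool), ?_, _, _,
    ofIndex_andParityFn_mem hC h h1 h2 hι (Fintype.equivFin _) false,
    ofIndex_andParityFn_mem hC h h1 h2 hι (Fintype.equivFin _) true,
    fun he => not_exists_andParityFn_comp h1 h2 hι (exists_of_equivalent_ofIndex he),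
    (fixingHypomorphic_andParityFn h1 h2).stronglyHypomorphic _⟩
  simp only [Fintype.card_sum, Fintype.card_prod, Fintype.card_bool]
  omega

theorem IsClone.hasHypomorphicPair_of_majOp {C : FnClass Bool Bool} (hC : IsClone C)
    (h : majOp ∈ C 3) (N : ℕ) : HasHypomorphicPair C N := by
  obtain ⟨ι, _, s, h1, h2, hι, hN⟩ := exists_cyclic_perm N
  refine ⟨Fintype.card (Bool ⊕ ι × Bool), ?_, _, _,
    ofIndex_selfDualParityFn_mem hC h h1 h2 hι (Fintype.equivFin _) false,
    ofIndex_selfDualParityFn_mem hC h h1 h2 hι (Fintype.equivFin _) true,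
    fun he => not_exists_selfDualParityFn_comp h1 hι (exists_of_equivalent_ofIndex he),
    (fixingHypomorphic_selfDualParityFn h1 h2).stronglyHypomorphic _⟩
  simp only [Fintype.card_sum, Fintype.card_prod, Fintype.card_bool]
  omega

theorem IsClone.hasHypomorphicPair {C : FnClass Bool Bool} (hC : IsClone C)
    (h : ¬ InLambdaVL C) (N : ℕ) : HasHypomorphicPair C N := by
  rcases hC.andOr_or_majOp_mem h with h | h | h
  · exact hC.hasHypomorphicPair_of_andOr h N
  · exact (hC.dualClass.hasHypomorphicPair_of_andOr h N).of_dualClass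
  · exact hC.hasHypomorphicPair_of_majOp h N

end SetRec

theorem mainTheorem1 (C : SetRec.FnClass Bool Bool) (hC : SetRec.IsClone C) :
    (SetRec.InLambdaVL C → (C.arityGE 4).SetReconstructible) ∧
    (¬ SetRec.InLambdaVL C →
      (∀ n : ℕ, 1 ≤ n → ¬ (C.arityGE n).WeaklyReconstructible) ∧
      (∀ N : ℕ, ∃ n : ℕ, N ≤ n ∧ ∃ f g : SetRec.Fn Bool Bool n,
        f ∈ C n ∧ g ∈ C n ∧ ¬ SetRec.Equivalent f g ∧ SetRec.StronglyHypomorphic f g)) := by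
  refine ⟨SetRec.setReconstructible_of_inLambdaVL, fun h => ⟨fun N _ hw => ?_,
    hC.hasHypomorphicPair h⟩⟩
  obtain ⟨n, hn, f, g, hf, hg, hne, hfg⟩ := hC.hasHypomorphicPair h N
  exact hne (hw n f ⟨hn, hf⟩ g ⟨hn, hg⟩ hfg.isReconstruction)
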